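/- Let $\mathbb K=\mathbb R$ or $\mathbb C$, $m\in\mathbb N$ with $m\ge 1$, and $1\le p<\infty$. Banach lattices over $\mathbb C$ are complexifications of real Banach lattices. For a Banach lattice $E$ let $E^+$ be its positive cone and $B_{E^*}^+$ the set of positive functionals in the closed unit ball $B_{E^*}$ of $E^*$. For a Banach lattice $E$ and a Banach space $X$ over $\mathbb K$, a bounded linear operator $u:E\to X$ is positive $p$-summing, $u\in\Pi_p^+(E;X)$, if there is $C>0$ such that $$\Big(\sum_{i=1}^n\|u(x_i)\|^p\Big)^{1/p}\le C\sup_{x^*\in B_{E^*}}\Big(\sum_{i=1}^n|x^*(x_i)|^p\Big)^{1/p}\qquad(n\in\mathbb N,\ x_1,\dots,x_n\in E^+).$$ For a Banach space $Y$, a continuous $m$-homogeneous polynomial $P:E\to Y$ is positive $p$-dominated, $P\in\mathcal P^+_{d,p}({}^mE;Y)$, if there is $C>0$ such that $$\Big(\sum_{i=1}^n\|P(x_i)\|^{p/m}\Big)^{m/p}\le C\sup_{x^*\in B_{E^*}^+}\Big(\sum_{i=1}^n|x^*(x_i)|^p\Big)^{m/p}\qquad(n\in\mathbb N,\ x_1,\dots,x_n\in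 E^+).$$ Then: 1. $\Pi_p^+$ is a positive right operator ideal: for all Banach lattices $E,G$ and Banach spaces $X,Z$, the set $\Pi_p^+(E;X)$ is a linear subspace of $\mathcal L(E;X)$ containing the bounded operators of finite rank, and $v\circ T\circ u\in\Pi_p^+(G;Z)$ whenever $T\in\Pi_p^+(E;X)$, $u:G\to E$ is a positive bounded operator and $v\in\mathcal L(X;Z)$. 2. $\mathcal P^+_{d,p}$ is a positive right ideal of $m$-homogeneous polynomials: for all Banach lattices $E,G$ and Banach spaces $Y,Z$, the set $\mathcal P^+_{d,p}({}^mE;Y)$ is a linear subspace of the space $\mathcal P({}^mE;Y)$ of continuous $m$-homogeneous polynomials, it contains the polynomials of finite type $x\mapsto\sum_{i=1}^k\varphi_i(x)^m y_i$ ($\varphi_i\in E^*$, $y_i\in Y$), and $v\circ P\circ u\in\mathcal P^+_{d,p}({}^mG;Z)$ whenever $P\in\mathcal P^+_{d,p}({}^mE;Y)$, $u:G\to E$ is a positive bounded operator and $v\in\mathcal L(Y;Z)$. 3. $\mathcal P^+_{d,p}$ is obtained from $\Pi_p^+$ by the factorization method: for every Banach lattice $E$ and Banach space $Y$, $$\mathcal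 P^+_{d,p}({}^mE;Y)=\mathcal P(\Pi_p^+)({}^mE;Y),$$ where $\mathcal P(\Pi_p^+)({}^mE;Y)$ is the set of all maps $P=Q\circ u$ with $X$ a Banach space, $u\in\Pi_p^+(E;X)$ and $Q\in\mathcal P({}^mX;Y)$. -/

import Mathlib

open scoped ComplexOrder

universe u w

namespace PositiveIdeals

section Lattices

variable (𝕜 : Type w) [RCLike 𝕜] {E : Type u} [NormedAddCommGroup E] [NormedSpace 𝕜 E]
  [PartialOrder E]

/-- The real part `E⁺ - E⁺` of an ordered space `E`. -/
def IsReal (x : E) : Prop := ∃ a b : E, 0 ≤ a ∧ 0 ≤ b ∧ x = a - b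

/-- `x` is the real part of `z`: `z = x + i y` with `x`, `y` real.
Over `𝕜 = ℝ` one has `RCLike.I = 0`, so this says `x = z`. -/
def IsRePart (z x : E) : Prop :=
  IsReal x ∧ ∃ y : E, IsReal y ∧ z = x + (RCLike.I : 𝕜) • y

/-- `m` is the modulus of `z`: the supremum of `Re (c z)` over all scalars `c` with `|c| = 1`.
Over `ℝ` this is `z ⊔ (-z)`; over `ℂ`, with `z = x + i y`, it is
`sup_θ (x cos θ + y sin θ)`. -/
def IsModulus (z m : E) : Prop :=
  IsLUB {x : E | ∃ c : 𝕜, ‖c‖ = 1 ∧ IsRePart 𝕜 (c • z) x} m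

variable (E)

/-- `E` is a Banach lattice over `𝕜`. Over `ℝ`: a complete normed vector lattice whose norm
satisfies `‖x‖ = ‖|x|‖`, and `0 ≤ a ≤ b → ‖a‖ ≤ ‖b‖`. Over `ℂ`: the complexification
`E = E_ℝ ⊕ i E_ℝ` of a real Banach lattice `E_ℝ = E⁺ - E⁺`, with norm `‖z‖ = ‖|z|‖`, and with
the order `x ≤ y ↔ y - x ∈ E⁺`. -/
class BanachLattice : Prop where
  complete : CompleteSpace E
  add_le_add_left : ∀ x y : E, x ≤ y → ∀ z : E, z + x ≤ z + y
  smul_nonneg : ∀ (r : ℝ) (x : E), 0 ≤ r → 0 ≤ x → 0 ≤ (r : 𝕜) • x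
  exists_sup : ∀ x y : E, IsReal x → IsReal y → ∃ s : E, IsLUB {x, y} s
  exists_rePart : ∀ z : E, ∃ x : E, IsRePart 𝕜 z x
  real_inter_I_smul_real : ∀ x : E, IsReal x → IsReal ((RCLike.I : 𝕜) • x) →
    (RCLike.I : 𝕜) • x = 0
  exists_modulus : ∀ z : E, ∃ m : E, IsModulus 𝕜 z m ∧ ‖m‖ = ‖z‖
  norm_le_norm : ∀ a b : E, 0 ≤ a → a ≤ b → ‖a‖ ≤ ‖b‖

end Lattices

section Operators

variable {𝕜 : Type w} [RCLike 𝕜] {E F : Type u}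
  [NormedAddCommGroup E] [NormedSpace 𝕜 E] [PartialOrder E]
  [NormedAddCommGroup F] [NormedSpace 𝕜 F]

/-- Positive operators. A functional `E →L[𝕜] 𝕜` is positive if it takes real values `≥ 0` on
the positive cone (the order of `𝕜` is `z ≤ w ↔ re z ≤ re w ∧ im z = im w`). -/
def IsPositive {F : Type*} [NormedAddCommGroup F] [NormedSpace 𝕜 F] [PartialOrder F]
    (u : E →L[𝕜] F) : Prop :=
  ∀ x : E, 0 ≤ x → 0 ≤ u x

variable (𝕜 E) in
/-- The positive part of the closed unit ball of the dual space. -/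
def positiveDualBall : Set (E →L[𝕜] 𝕜) := {φ | ‖φ‖ ≤ 1 ∧ IsPositive φ}

variable (𝕜) in
/-- The weak `ℓ_p` norm `sup_{‖φ‖ ≤ 1} (∑ |φ (x i)|^p)^(1/p)` of a finite sequence. -/
noncomputable def weakNorm {X : Type u} [NormedAddCommGroup X] [NormedSpace 𝕜 X] (p : ℝ) {n : ℕ}
    (x : Fin n → X) : ℝ :=
  ⨆ φ : Metric.closedBall (0 : X →L[𝕜] 𝕜) 1, (∑ i, ‖φ.1 (x i)‖ ^ p) ^ (1 / p)

end Operators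

section Polynomials

variable (𝕜 : Type w) [RCLike 𝕜] (m : ℕ) (X Y : Type u)
  [NormedAddCommGroup X] [NormedSpace 𝕜 X] [NormedAddCommGroup Y] [NormedSpace 𝕜 Y]

/-- The space `𝒫(^m X; Y)` of continuous `m`-homogeneous polynomials from `X` to `Y`. -/
def ContPoly : Set (X → Y) :=
  {P | ∃ A : ContinuousMultilinearMap 𝕜 (fun _ : Fin m => X) Y,
    (∀ (σ : Equiv.Perm (Fin m)) (x : Fin m → X), A (fun i => x (σ i)) = A x) ∧
    ∀ x : X, P x = A (fun _ => x)}

/-- The `m`-homogeneous polynomials of finite type, `x ↦ ∑ φ i (x) ^ m • y i`. -/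
def FiniteType : Set (X → Y) :=
  {P | ∃ (k : ℕ) (φ : Fin k → X →L[𝕜] 𝕜) (y : Fin k → Y), ∀ x : X, P x = ∑ i, (φ i x) ^ m • y i}

end Polynomials

section Ideals

variable (𝕜 : Type w) [RCLike 𝕜]

/-- A class of continuous linear operators from Banach lattices to Banach spaces. -/
abbrev OperatorClass :=
  ∀ (E : Type u) [NormedAddCommGroup E] [NormedSpace 𝕜 E] [PartialOrder E] [BanachLattice 𝕜 E]
    (X : Type u) [NormedAddCommGroup X] [NormedSpace 𝕜 X] [CompleteSpace X], Set (E →L[𝕜] X)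

/-- A class of maps from Banach lattices to Banach spaces. -/
abbrev MapClass :=
  ∀ (E : Type u) [NormedAddCommGroup E] [NormedSpace 𝕜 E] [PartialOrder E] [BanachLattice 𝕜 E]
    (Y : Type u) [NormedAddCommGroup Y] [NormedSpace 𝕜 Y] [CompleteSpace Y], Set (E → Y)

variable {𝕜}

/-- Positive right operator ideals: the components are linear subspaces containing the operators
of finite rank, and are stable under composition with positive operators between Banach lattices
on the right and with bounded operators between Banach spaces on the left. -/
structure IsPositiveRightOperatorIdeal (B : OperatorClass.{u, w} 𝕜) : Prop where
  isSubspace : ∀ (E : Type u) [NormedAddCommGroup E] [NormedSpace 𝕜 E] [PartialOrder E]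
    [BanachLattice 𝕜 E] (X : Type u) [NormedAddCommGroup X] [NormedSpace 𝕜 X] [CompleteSpace X],
    ∃ S : Submodule 𝕜 (E →L[𝕜] X), (S : Set (E →L[𝕜] X)) = B E X
  finiteRank : ∀ (E : Type u) [NormedAddCommGroup E] [NormedSpace 𝕜 E] [PartialOrder E]
    [BanachLattice 𝕜 E] (X : Type u) [NormedAddCommGroup X] [NormedSpace 𝕜 X] [CompleteSpace X]
    (T : E →L[𝕜] X), FiniteDimensional 𝕜 (LinearMap.range (T : E →ₗ[𝕜] X)) → T ∈ B E X
  comp : ∀ (E : Type u) [NormedAddCommGroup E] [NormedSpace 𝕜 E] [PartialOrder E]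
    [BanachLattice 𝕜 E] (G : Type u) [NormedAddCommGroup G] [NormedSpace 𝕜 G] [PartialOrder G]
    [BanachLattice 𝕜 G] (X : Type u) [NormedAddCommGroup X] [NormedSpace 𝕜 X] [CompleteSpace X]
    (Z : Type u) [NormedAddCommGroup Z] [NormedSpace 𝕜 Z] [CompleteSpace Z]
    (T : E →L[𝕜] X) (u : G →L[𝕜] E) (v : X →L[𝕜] Z),
    T ∈ B E X → IsPositive u → (v.comp T).comp u ∈ B G Z

/-- Positive right ideals of `m`-homogeneous polynomials: the components are linear subspaces of
the space of continuous `m`-homogeneous polynomials which contain the polynomials of finite type,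
and are stable under composition with positive operators between Banach lattices on the right and
with bounded operators between Banach spaces on the left. -/
structure IsPositiveRightPolynomialIdeal (m : ℕ) (Q : MapClass.{u, w} 𝕜) : Prop where
  isSubspace : ∀ (E : Type u) [NormedAddCommGroup E] [NormedSpace 𝕜 E] [PartialOrder E]
    [BanachLattice 𝕜 E] (Y : Type u) [NormedAddCommGroup Y] [NormedSpace 𝕜 Y] [CompleteSpace Y],
    Q E Y ⊆ ContPoly 𝕜 m E Y ∧ ∃ S : Submodule 𝕜 (E → Y), (S : Set (E → Y)) = Q E Y
  finiteType : ∀ (E : Type u) [NormedAddCommGroup E] [NormedSpace 𝕜 E] [PartialOrder E]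
    [BanachLattice 𝕜 E] (Y : Type u) [NormedAddCommGroup Y] [NormedSpace 𝕜 Y] [CompleteSpace Y],
    FiniteType 𝕜 m E Y ⊆ Q E Y
  comp : ∀ (E : Type u) [NormedAddCommGroup E] [NormedSpace 𝕜 E] [PartialOrder E]
    [BanachLattice 𝕜 E] (G : Type u) [NormedAddCommGroup G] [NormedSpace 𝕜 G] [PartialOrder G]
    [BanachLattice 𝕜 G] (Y : Type u) [NormedAddCommGroup Y] [NormedSpace 𝕜 Y] [CompleteSpace Y]
    (Z : Type u) [NormedAddCommGroup Z] [NormedSpace 𝕜 Z] [CompleteSpace Z]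
    (P : E → Y) (u : G →L[𝕜] E) (v : Y →L[𝕜] Z),
    P ∈ Q E Y → IsPositive u → (fun x => v (P (u x))) ∈ Q G Z

variable (𝕜)

/-- The class `Π_p⁺` of positive `p`-summing operators. -/
def PositiveSumming (p : ℝ) : OperatorClass.{u, w} 𝕜 := fun E _ _ _ _ X _ _ _ =>
  {T : E →L[𝕜] X | ∃ C : ℝ, 0 < C ∧ ∀ (n : ℕ) (x : Fin n → E), (∀ i, 0 ≤ x i) →
    (∑ i, ‖T (x i)‖ ^ p) ^ (1 / p) ≤ C * weakNorm 𝕜 p x}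

/-- The class of positive `p`-dominated `m`-homogeneous polynomials. -/
def PositiveDominated (m : ℕ) (p : ℝ) : MapClass.{u, w} 𝕜 := fun E _ _ _ _ Y _ _ _ =>
  {P : E → Y | P ∈ ContPoly 𝕜 m E Y ∧ ∃ C : ℝ, 0 < C ∧
    ∀ (n : ℕ) (x : Fin n → E), (∀ i, 0 ≤ x i) →
      (∑ i, ‖P (x i)‖ ^ (p / m)) ^ (m / p) ≤
        C * ⨆ φ : positiveDualBall 𝕜 E, (∑ i, ‖φ.1 (x i)‖ ^ p) ^ (m / p)}

variable {𝕜}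

/-- The factorization method: the polynomials `P = Q ∘ T`, where `T : E → X` is in the operator
class `B` for some Banach space `X`, and `Q` is a continuous `m`-homogeneous polynomial on `X`. -/
def Factorization (m : ℕ) (B : OperatorClass.{u, w} 𝕜) : MapClass.{u, w} 𝕜 :=
  fun E _ _ _ _ Y _ _ _ =>
  {P : E → Y | ∃ (X : Type u) (_ : NormedAddCommGroup X) (_ : NormedSpace 𝕜 X)
    (_ : CompleteSpace X) (T : E →L[𝕜] X) (Q : X → Y),
    T ∈ B E X ∧ Q ∈ ContPoly 𝕜 m X Y ∧ P = Q ∘ T}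

end Ideals

end PositiveIdeals

namespace PositiveIdeals

/-! ### Real parts, moduli and the four-part decomposition -/

section Order

/-! On positive vectors the weak `ℓ_p` supremum over the whole dual ball equals the one over its
positive part, because every functional `φ` is dominated on the cone by a positive functional of no
larger norm (`exists_isPositive_dominating`). Both classes are thus given by one kind of estimate,
`∑ ‖f (x i)‖ ^ q ≤ C * sup_φ ∑ |φ (x i)| ^ p` on positive vectors, with `q = p` for operators and `q
= p / m` for polynomials. Linearity, finite rank and finite type then follow from elementary
inequalities.

The substance is the factorization of a dominated `P`. Hahn-Banach separation yields a positive
normalized functional `L` on the bounded continuous functions on the positive dual ball with `‖P x‖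
^ (p / m) ≤ C * L (|φ x| ^ p)` for `x ≥ 0`, a Pietsch domination in which `L` plays the role of the
measure (`exists_functional_of_dominated`). Then `ρ z = L (|φ |z|| ^ p) ^ (1 / p)` is a seminorm
monotone in the modulus; `E` maps into its completion `X` by a positive `p`-summing operator, and
`‖P x‖ ≤ C' * ρ x ^ m` on the cone.

It remains to extend the symmetric form of `P` to `X`. Polarization by sums over subsets, without
differences, evaluates `P` only at sums of positive vectors, so it bounds the form there; writing
any `z` with four positive elements below `|z|` bounds it everywhere by a multiple of `∏ ρ (z i)`
(`exists_multilinear_bound`). Density does the rest. -/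

theorem IsReal.add {E : Type*} [NormedAddCommGroup E] [PartialOrder E] [IsOrderedAddMonoid E]
    {x y : E} (hx : IsReal x) (hy : IsReal y) : IsReal (x + y) := by
  obtain ⟨a, b, ha, hb, rfl⟩ := hx
  obtain ⟨c, d, hc, hd, rfl⟩ := hy
  exact ⟨a + c, b + d, add_nonneg ha hc, add_nonneg hb hd, by abel⟩

theorem IsReal.neg {E : Type*} [NormedAddCommGroup E] [PartialOrder E]
    {x : E} (hx : IsReal x) : IsReal (-x) := by
  obtain ⟨a, b, ha, hb, rfl⟩ := hx
  exact ⟨b, a, hb, ha, by abel⟩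

theorem isReal_of_nonneg {E : Type*} [NormedAddCommGroup E] [PartialOrder E]
    {x : E} (hx : 0 ≤ x) : IsReal x := ⟨x, 0, hx, le_rfl, by simp⟩

theorem isReal_zero {E : Type*} [NormedAddCommGroup E] [PartialOrder E] : IsReal (0 : E) :=
  isReal_of_nonneg le_rfl

theorem IsReal.isRePart {𝕜 : Type w} [RCLike 𝕜] {E : Type u} [NormedAddCommGroup E]
    [NormedSpace 𝕜 E] [PartialOrder E] {x : E} (h : IsReal x) : IsRePart 𝕜 x x :=
  ⟨h, 0, isReal_zero, by simp⟩

variable {𝕜 : Type w} [RCLike 𝕜] {E : Type u} [NormedAddCommGroup E] [NormedSpace 𝕜 E]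
  [PartialOrder E] [BanachLattice 𝕜 E]

theorem BanachLattice.isOrderedAddMonoid (𝕜 : Type w) [RCLike 𝕜] (E : Type u)
    [NormedAddCommGroup E] [NormedSpace 𝕜 E] [PartialOrder E] [BanachLattice 𝕜 E] :
    IsOrderedAddMonoid E :=
  { add_le_add_left := fun x y h z => by
      simpa [add_comm] using BanachLattice.add_le_add_left 𝕜 x y h z }

theorem IsReal.real_smul {x : E} (r : ℝ) (hx : IsReal x) : IsReal ((r : 𝕜) • x) := by
  obtain ⟨a, b, ha, hb, rfl⟩ := hx
  rcases le_total 0 r with hr | hr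
  · exact ⟨_, _, BanachLattice.smul_nonneg r a hr ha, BanachLattice.smul_nonneg r b hr hb,
      smul_sub _ _ _⟩
  · refine ⟨_, _, BanachLattice.smul_nonneg (𝕜 := 𝕜) (-r) b (by linarith) hb,
      BanachLattice.smul_nonneg (𝕜 := 𝕜) (-r) a (by linarith) ha, ?_⟩
    push_cast
    module

theorem real_smul_le_real_smul {x y : E} {r : ℝ} (hr : 0 ≤ r) (h : x ≤ y) :
    (r : 𝕜) • x ≤ (r : 𝕜) • y := by
  have := BanachLattice.isOrderedAddMonoid 𝕜 E
  have h2 := BanachLattice.smul_nonneg (𝕜 := 𝕜) r (y - x) hr (sub_nonneg.2 h)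
  rwa [smul_sub, sub_nonneg] at h2

theorem real_smul_le_real_smul_of_le {x : E} {r s : ℝ} (hx : 0 ≤ x) (h : r ≤ s) :
    (r : 𝕜) • x ≤ (s : 𝕜) • x := by
  have := BanachLattice.isOrderedAddMonoid 𝕜 E
  have h2 := BanachLattice.smul_nonneg (𝕜 := 𝕜) (s - r) x (sub_nonneg.2 h) hx
  rwa [RCLike.ofReal_sub, sub_smul, sub_nonneg] at h2

theorem IsRePart.add {z w x y : E} (h : IsRePart 𝕜 z x) (h' : IsRePart 𝕜 w y) :
    IsRePart 𝕜 (z + w) (x + y) := by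
  have := BanachLattice.isOrderedAddMonoid 𝕜 E
  obtain ⟨hx, a, ha, rfl⟩ := h
  obtain ⟨hy, b, hb, rfl⟩ := h'
  exact ⟨hx.add hy, a + b, ha.add hb, by rw [smul_add]; abel⟩

theorem IsRePart.real_smul {z x : E} (r : ℝ) (h : IsRePart 𝕜 z x) :
    IsRePart 𝕜 ((r : 𝕜) • z) ((r : 𝕜) • x) := by
  obtain ⟨hx, a, ha, rfl⟩ := h
  exact ⟨hx.real_smul r, _, ha.real_smul (𝕜 := 𝕜) r, by rw [smul_add, smul_comm]⟩

/-- The difference of two real parts is real and also `I` times a real element, hence zero. The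
argument covers `𝕜 = ℝ` too, where `I = 0`. -/
theorem IsRePart.unique {z x y : E} (h : IsRePart 𝕜 z x) (h' : IsRePart 𝕜 z y) : x = y := by
  have := BanachLattice.isOrderedAddMonoid 𝕜 E
  obtain ⟨hx, a, ha, rfl⟩ := h
  obtain ⟨hy, b, hb, h⟩ := h'
  have h1 : (RCLike.I : 𝕜) • (b + -a) = x + -y := by
    rw [smul_add, smul_neg, ← sub_eq_add_neg, ← sub_eq_add_neg, sub_eq_sub_iff_add_eq_add, h]
    abel
  have h2 := BanachLattice.real_inter_I_smul_real (𝕜 := 𝕜) _ (hb.add ha.neg)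
    (by rw [h1]; exact hx.add hy.neg)
  rw [h1, ← sub_eq_add_neg, sub_eq_zero] at h2
  exact h2

theorem IsReal.isRePart_smul {x : E} (h : IsReal x) (c : 𝕜) :
    IsRePart 𝕜 (c • x) ((RCLike.re c : 𝕜) • x) := by
  refine ⟨h.real_smul _, _, h.real_smul (𝕜 := 𝕜) (RCLike.im c), ?_⟩
  conv_lhs => rw [← RCLike.re_add_im c]
  rw [add_smul, smul_smul, mul_comm]

variable (𝕜) in
/-- The modulus `|z|` of an element of a Banach lattice. -/
noncomputable def modulus (z : E) : E := (BanachLattice.exists_modulus (𝕜 := 𝕜) z).choose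

theorem isModulus_modulus (z : E) : IsModulus 𝕜 z (modulus 𝕜 z) :=
  (BanachLattice.exists_modulus (𝕜 := 𝕜) z).choose_spec.1

theorem norm_modulus (z : E) : ‖modulus 𝕜 z‖ = ‖z‖ :=
  (BanachLattice.exists_modulus (𝕜 := 𝕜) z).choose_spec.2

theorem IsRePart.le_modulus {z x : E} {c : 𝕜} (hc : ‖c‖ = 1) (h : IsRePart 𝕜 (c • z) x) :
    x ≤ modulus 𝕜 z := (isModulus_modulus z).1 ⟨c, hc, h⟩

theorem modulus_le {z b : E} (h : ∀ (c : 𝕜) (x : E), ‖c‖ = 1 → IsRePart 𝕜 (c • z) x → x ≤ b) :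
    modulus 𝕜 z ≤ b := (isModulus_modulus z).2 fun x ⟨c, hc, hx⟩ => h c x hc hx

theorem nonneg_of_le_of_neg_le (𝕜 : Type w) [RCLike 𝕜] {E : Type u} [NormedAddCommGroup E]
    [NormedSpace 𝕜 E] [PartialOrder E] [BanachLattice 𝕜 E] 
    {x m : E} (h : x ≤ m) (h' : -x ≤ m) : 0 ≤ m := by
  have := BanachLattice.isOrderedAddMonoid 𝕜 E
  have h2 : 0 ≤ m + m := by simpa using add_le_add h h'
  have h3 := BanachLattice.smul_nonneg (𝕜 := 𝕜) (1 / 2) _ (by norm_num) h2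
  rwa [smul_add, ← add_smul, ← RCLike.ofReal_add, add_halves, RCLike.ofReal_one, one_smul] at h3

theorem IsRePart.neg {z x : E} (h : IsRePart 𝕜 z x) : IsRePart 𝕜 (-z) (-x) := by
  simpa using h.real_smul (-1)

theorem modulus_nonneg (z : E) : 0 ≤ modulus 𝕜 z := by
  obtain ⟨x, hx⟩ := BanachLattice.exists_rePart (𝕜 := 𝕜) z
  exact nonneg_of_le_of_neg_le 𝕜
    (IsRePart.le_modulus (c := (1 : 𝕜)) (by simp) (by simpa using hx))
    (IsRePart.le_modulus (c := (-1 : 𝕜)) (by simp) (by simpa using hx.neg))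

theorem modulus_add_le (z w : E) : modulus 𝕜 (z + w) ≤ modulus 𝕜 z + modulus 𝕜 w := by
  have := BanachLattice.isOrderedAddMonoid 𝕜 E
  refine modulus_le fun c x hc hx => ?_
  obtain ⟨a, ha⟩ := BanachLattice.exists_rePart (𝕜 := 𝕜) (c • z)
  obtain ⟨b, hb⟩ := BanachLattice.exists_rePart (𝕜 := 𝕜) (c • w)
  rw [smul_add] at hx
  rw [hx.unique (ha.add hb)]
  exact add_le_add (ha.le_modulus hc) (hb.le_modulus hc)

theorem modulus_of_nonneg {x : E} (hx : 0 ≤ x) : modulus 𝕜 x = x := by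
  refine le_antisymm (modulus_le fun c y hc hy => ?_) ?_
  · rw [hy.unique ((isReal_of_nonneg hx).isRePart_smul c)]
    simpa using real_smul_le_real_smul_of_le (𝕜 := 𝕜) hx ((RCLike.re_le_norm c).trans_eq hc)
  · exact IsRePart.le_modulus (c := (1 : 𝕜)) (by simp)
      (by simpa using (isReal_of_nonneg hx).isRePart)

/-- The phase `c / ‖c‖` is absorbed by the unimodular scalar in the supremum defining the modulus.
-/
theorem modulus_smul_le (c : 𝕜) (z : E) : modulus 𝕜 (c • z) ≤ (‖c‖ : 𝕜) • modulus 𝕜 z := by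
  rcases eq_or_ne c 0 with rfl | hc
  · simp [modulus_of_nonneg (𝕜 := 𝕜) (le_refl (0 : E))]
  refine modulus_le fun d x hd hx => ?_
  have hc' : (‖c‖ : 𝕜) ≠ 0 := by simpa using hc
  obtain ⟨a, ha⟩ := BanachLattice.exists_rePart (𝕜 := 𝕜) ((d * c / ‖c‖) • z)
  have h1 := ha.real_smul ‖c‖
  rw [smul_smul, mul_div_cancel₀ _ hc'] at h1
  rw [smul_smul] at hx
  rw [hx.unique h1]
  refine real_smul_le_real_smul (norm_nonneg _) (ha.le_modulus ?_)
  simp [hd, hc]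

/-- Take `a = (m + x) / 2` and `b = (m - x) / 2`; positive and negative parts are not needed. -/
theorem exists_nonneg_eq_sub (𝕜 : Type w) [RCLike 𝕜] {E : Type u} [NormedAddCommGroup E]
    [NormedSpace 𝕜 E] [PartialOrder E] [BanachLattice 𝕜 E] 
    {x m : E} (h : x ≤ m) (h' : -x ≤ m) :
    ∃ a b : E, 0 ≤ a ∧ 0 ≤ b ∧ a ≤ m ∧ b ≤ m ∧ x = a - b := by
  have := BanachLattice.isOrderedAddMonoid 𝕜 E
  have h2 : ((1 / 2 : ℝ) : 𝕜) • m + ((1 / 2 : ℝ) : 𝕜) • m = m := by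
    rw [← add_smul, ← RCLike.ofReal_add]; norm_num
  have hx : ((1 / 2 : ℝ) : 𝕜) • x + ((1 / 2 : ℝ) : 𝕜) • x = x := by
    rw [← add_smul, ← RCLike.ofReal_add]; norm_num
  have key : ∀ y : E, y ≤ m → -y ≤ m → 0 ≤ ((1 / 2 : ℝ) : 𝕜) • (m + y) ∧
      ((1 / 2 : ℝ) : 𝕜) • (m + y) ≤ m := fun y hy hy' => by
    constructor
    · exact BanachLattice.smul_nonneg _ _ (by norm_num) (by simpa using add_le_add hy' (le_refl y))
    · rw [smul_add]
      conv_rhs => rw [← h2]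
      gcongr
      exact real_smul_le_real_smul (by norm_num) hy
  refine ⟨_, _, (key x h h').1, (key (-x) h' (by simpa using h)).1, (key x h h').2,
    (key (-x) h' (by simpa using h)).2, ?_⟩
  conv_lhs => rw [← hx]
  module

variable (𝕜) in
/-- Every `z` is a combination of four positive elements below its modulus. -/
theorem exists_eq_sum_nonneg (z : E) : ∃ (c : Fin 4 → 𝕜) (a : Fin 4 → E),
    (∀ j, ‖c j‖ ≤ 1) ∧ (∀ j, 0 ≤ a j ∧ a j ≤ modulus 𝕜 z) ∧ z = ∑ j, c j • a j := by
  obtain ⟨x, hx⟩ := BanachLattice.exists_rePart (𝕜 := 𝕜) z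
  obtain ⟨hxr, y, hy, hz⟩ := id hx
  obtain ⟨a, b, ha, hb, ham, hbm, hab⟩ := exists_nonneg_eq_sub 𝕜
    (IsRePart.le_modulus (c := (1 : 𝕜)) (by simp) (by simpa using hx))
    (IsRePart.le_modulus (c := (-1 : 𝕜)) (by simp) (by simpa using hx.neg))
  -- Over `ℝ` the element `y` is arbitrary, since `I = 0`, and is replaced by `0`. Over `ℂ` it is
  -- the real part of `-I • z`, so the modulus bounds it.
  have hI : ∃ y' : E, y' ≤ modulus 𝕜 z ∧ -y' ≤ modulus 𝕜 z ∧
      (RCLike.I : 𝕜) • y = (RCLike.I : 𝕜) • y' := by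
    rcases eq_or_ne (RCLike.I : 𝕜) 0 with h | h
    · exact ⟨0, modulus_nonneg z, by simpa using modulus_nonneg z, by simp [h]⟩
    · have hII : (RCLike.I : 𝕜) * RCLike.I = -1 :=
        RCLike.I_mul_I_of_nonzero h
      have hn : ‖(RCLike.I : 𝕜)‖ = 1 := RCLike.norm_I_of_ne_zero h
      have h1 : IsRePart 𝕜 ((-RCLike.I : 𝕜) • z) y :=
        ⟨hy, -x, hxr.neg, by rw [hz, smul_add, smul_smul, neg_mul, hII]; simp [add_comm]⟩
      refine ⟨y, h1.le_modulus (by simpa using hn), ?_, rfl⟩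
      have h2 := h1.neg
      rw [← neg_smul, neg_neg] at h2
      exact h2.le_modulus hn
  obtain ⟨y', h1, h2, h3⟩ := hI
  obtain ⟨c, d, hc, hd, hcm, hdm, hcd⟩ := exists_nonneg_eq_sub 𝕜 h1 h2
  refine ⟨![1, -1, RCLike.I, -RCLike.I], ![a, b, c, d], ?_, ?_, ?_⟩
  · have : ‖(RCLike.I : 𝕜)‖ ≤ 1 := by
      rcases eq_or_ne (RCLike.I : 𝕜) 0 with h | h
      · simp [h]
      · exact (RCLike.norm_I_of_ne_zero h).le
    intro j; fin_cases j <;> simp [this]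
  · rw [Fin.forall_fin_succ, Fin.forall_fin_succ, Fin.forall_fin_two]
    exact ⟨⟨ha, ham⟩, ⟨hb, hbm⟩, ⟨hc, hcm⟩, ⟨hd, hdm⟩⟩
  · rw [hz, h3, hab, hcd, Fin.sum_univ_four]
    simp
    module

end Order

/-! ### Separation of cones and positive functionals on bounded functions -/

section Separation

theorem exists_dual_separating_cones {V : Type*} [AddCommGroup V] [TopologicalSpace V]
    [IsTopologicalAddGroup V] [Module ℝ V] [ContinuousSMul ℝ V] (s t : ConvexCone ℝ V)
    (hs : IsOpen (s : Set V)) (ht : (0 : V) ∈ t) (hst : Disjoint (s : Set V) t) :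
    ∃ L : V →L[ℝ] ℝ, (∀ x ∈ s, L x < 0) ∧ ∀ y ∈ t, 0 ≤ L y := by
  obtain ⟨L, r, h1, h2⟩ := geometric_hahn_banach_open s.convex hs t.convex hst
  have hr : r ≤ 0 := by simpa using h2 0 ht
  refine ⟨L, fun x hx => (h1 x hx).trans_le hr, fun y hy => ?_⟩
  by_contra! hneg
  -- Scaling `y` makes `L` take the value `r - 1`, below the bound `r` valid on `t`.
  have h3 := h2 _ (t.smul_mem (c := (r - 1) / L y) (div_pos_of_neg_of_neg (by linarith) hneg) hy)
  rw [map_smul, smul_eq_mul, div_mul_cancel₀ _ hneg.ne] at h3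
  linarith

open scoped BoundedContinuousFunction

/-- A convex cone of bounded functions with nonpositive infima is annihilated from above by a
positive normalized functional. -/
theorem exists_positive_functional_nonpos {K : Type*} [TopologicalSpace K] [Nonempty K]
    (t : ConvexCone ℝ (K →ᵇ ℝ)) (h0 : (0 : K →ᵇ ℝ) ∈ t)
    (h : ∀ f ∈ t, ∀ ε > 0, ∃ k, f k < ε) :
    ∃ L : (K →ᵇ ℝ) →ₗ[ℝ] ℝ, (∀ f, (∀ k, 0 ≤ f k) → 0 ≤ L f) ∧ L 1 = 1 ∧ ∀ f ∈ t, L f ≤ 0 := by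
  -- Functions bounded below by a positive constant form an open cone, which misses `t` by
  -- hypothesis. The separating functional is negative there, whence the normalization by `(L 1)⁻¹`.
  let s : ConvexCone ℝ (K →ᵇ ℝ) :=
    { carrier := {f | ∃ ε > 0, ∀ k, ε ≤ f k}
      smul_mem' := fun c hc f ⟨ε, hε, hf⟩ =>
        ⟨c * ε, mul_pos hc hε, fun k => mul_le_mul_of_nonneg_left (hf k) hc.le⟩
      add_mem' := fun f ⟨ε, hε, hf⟩ g ⟨δ, hδ, hg⟩ =>
        ⟨ε + δ, add_pos hε hδ, fun k => add_le_add (hf k) (hg k)⟩ }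
  have hs : IsOpen (s : Set (K →ᵇ ℝ)) := by
    rw [Metric.isOpen_iff]
    rintro f ⟨ε, hε, hf⟩
    refine ⟨ε / 2, half_pos hε, fun g hg => ⟨ε / 2, half_pos hε, fun k => ?_⟩⟩
    have h1 := (BoundedContinuousFunction.dist_coe_le_dist (f := g) (g := f) k).trans_lt hg
    rw [Real.dist_eq] at h1
    linarith [neg_abs_le (g k - f k), hf k]
  have hst : Disjoint (s : Set (K →ᵇ ℝ)) t := by
    rw [Set.disjoint_left]
    rintro f ⟨ε, hε, hf⟩ hft
    obtain ⟨k, hk⟩ := h f hft ε hε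
    exact (hf k).not_gt hk
  obtain ⟨L, hL, hL'⟩ := exists_dual_separating_cones s t hs h0 hst
  have h1 : L 1 < 0 := hL 1 ⟨1, one_pos, fun k => le_rfl⟩
  refine ⟨(L 1)⁻¹ • L.toLinearMap, fun f hf => ?_, by simp [h1.ne], fun f hf => ?_⟩
  · have h2 : L f ≤ 0 := by
      by_contra! hpos
      -- The added constant puts `f` into `s` and is chosen so that `L` vanishes at the sum,
      -- contradicting `L < 0` on `s`.
      have h3 := hL (f + (L f / (-L 1)) • 1) ⟨L f / (-L 1), div_pos hpos (neg_pos.2 h1), fun k => by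
        simpa using hf k⟩
      rw [map_add, map_smul, smul_eq_mul, div_neg, neg_mul, div_mul_cancel₀ _ h1.ne] at h3
      linarith
    exact mul_nonneg_of_nonpos_of_nonpos (inv_nonpos.2 h1.le) h2
  · exact mul_nonpos_of_nonpos_of_nonneg (inv_nonpos.2 h1.le) (hL' f hf)

/-- Minkowski's inequality for positive functionals. -/
theorem rpow_functional_le_add {K : Type*} [TopologicalSpace K] {p : ℝ} (hp : 1 ≤ p)
    (L : (K →ᵇ ℝ) →ₗ[ℝ] ℝ) (hL : ∀ f, (∀ k, 0 ≤ f k) → 0 ≤ L f) (F G H : K →ᵇ ℝ) (a b : K → ℝ)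
    (ha : ∀ k, 0 ≤ a k) (hb : ∀ k, 0 ≤ b k) (hF : ∀ k, F k = a k ^ p) (hG : ∀ k, G k = b k ^ p)
    (hH : ∀ k, H k ≤ (a k + b k) ^ p) (hH0 : ∀ k, 0 ≤ H k) :
    L H ^ (1 / p) ≤ L F ^ (1 / p) + L G ^ (1 / p) := by
  have hp0 : 0 < p := by linarith
  have hLF : 0 ≤ L F := hL F fun k => by rw [hF]; exact Real.rpow_nonneg (ha k) _
  have hLG : 0 ≤ L G := hL G fun k => by rw [hG]; exact Real.rpow_nonneg (hb k) _
  refine le_of_forall_pos_le_add fun ε hε => ?_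
  -- The summand `ε / 2` allows division by `α` and `β` even when `L F` or `L G` vanishes.
  set α := L F ^ (1 / p) + ε / 2 with hα
  set β := L G ^ (1 / p) + ε / 2 with hβ
  have hα0 : 0 < α := by positivity
  have hβ0 : 0 < β := by positivity
  have hFα : L F / α ^ p ≤ 1 := by
    rw [div_le_one (by positivity)]
    calc L F = (L F ^ (1 / p)) ^ p := by
          rw [← Real.rpow_mul hLF, one_div_mul_cancel hp0.ne', Real.rpow_one]
      _ ≤ α ^ p := by gcongr; linarith
  have hGβ : L G / β ^ p ≤ 1 := by
    rw [div_le_one (by positivity)]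
    calc L G = (L G ^ (1 / p)) ^ p := by
          rw [← Real.rpow_mul hLG, one_div_mul_cancel hp0.ne', Real.rpow_one]
      _ ≤ β ^ p := by gcongr; linarith
  set c := α / (α + β) with hc
  set d := β / (α + β) with hd
  have hcd : c + d = 1 := by rw [hc, hd]; field_simp
  have hc0 : 0 ≤ c := by positivity
  have hd0 : 0 ≤ d := by positivity
  -- Pointwise convexity of `t ^ p` at `a / α` and `b / β`, with weights `c` and `d`, is transported
  -- by positivity of `L`.
  have key : 0 ≤ L ((α + β) ^ p • ((c / α ^ p) • F + (d / β ^ p) • G) - H) := by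
    refine hL _ fun k => ?_
    have h1 := (convexOn_rpow hp).2 (Set.mem_Ici.2 (div_nonneg (ha k) hα0.le))
      (Set.mem_Ici.2 (div_nonneg (hb k) hβ0.le)) hc0 hd0 hcd
    have h2 : a k + b k = (α + β) * (c • (a k / α) + d • (b k / β)) := by
      simp only [smul_eq_mul, hc, hd]; field_simp
    have h3 : H k ≤ (α + β) ^ p * (c • (a k / α) ^ p + d • (b k / β) ^ p) := by
      refine (hH k).trans ?_
      simp only [smul_eq_mul] at h1 h2 ⊢
      rw [h2, Real.mul_rpow (by positivity)
        (add_nonneg (mul_nonneg hc0 (div_nonneg (ha k) hα0.le))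
          (mul_nonneg hd0 (div_nonneg (hb k) hβ0.le)))]
      gcongr
    simp only [BoundedContinuousFunction.coe_sub, BoundedContinuousFunction.coe_smul,
      BoundedContinuousFunction.coe_add, Pi.sub_apply, Pi.add_apply, smul_eq_mul, hF, hG]
    rw [Real.div_rpow (ha k) hα0.le, Real.div_rpow (hb k) hβ0.le] at h3
    refine sub_nonneg.2 (h3.trans_eq ?_)
    simp only [smul_eq_mul]
    ring
  simp only [map_sub, map_smul, map_add, smul_eq_mul] at key
  have h5 : L H ≤ (α + β) ^ p := by
    calc L H ≤ (α + β) ^ p * (c / α ^ p * L F + d / β ^ p * L G) := by linarith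
      _ = (α + β) ^ p * (c * (L F / α ^ p) + d * (L G / β ^ p)) := by ring
      _ ≤ (α + β) ^ p * (c * 1 + d * 1) := by gcongr
      _ = (α + β) ^ p := by rw [mul_one, mul_one, hcd, mul_one]
  calc L H ^ (1 / p) ≤ ((α + β) ^ p) ^ (1 / p) :=
        Real.rpow_le_rpow (hL H hH0) h5 (by positivity)
    _ = α + β := by
        rw [← Real.rpow_mul (by positivity), mul_one_div_cancel hp0.ne', Real.rpow_one]
    _ = _ := by rw [hα, hβ]; ring

end Separation

/-! ### Domination of functionals by positive ones -/

section Domination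

variable {𝕜 : Type w} [RCLike 𝕜] {E : Type u} [NormedAddCommGroup E] [NormedSpace 𝕜 E]
  [PartialOrder E] [BanachLattice 𝕜 E]

theorem IsRePart.norm_le {z x : E} (h : IsRePart 𝕜 z x) (hx : 0 ≤ x) : ‖x‖ ≤ ‖z‖ := by
  rw [← norm_modulus (𝕜 := 𝕜) z]
  exact BanachLattice.norm_le_norm 𝕜 _ _ hx
    (IsRePart.le_modulus (c := (1 : 𝕜)) (by simp) (by simpa using h))

/-- A sandwich argument in `E × ℝ`. The cone `s` lies strictly above the graph of `‖φ‖ * ‖z‖`, while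
`t` lies below the superlinear function `sup {Re φ(v) : |v| ≤ Re z}`, defined where `Re z ≥ 0`. They
are disjoint because the norm is monotone, and a separating hyperplane is the graph of a real
functional `f` between the two functions. The upper bound controls the norm, the lower one gives
positivity and domination. -/
theorem exists_isPositive_dominating_aux [NormedSpace ℝ E] [IsScalarTower ℝ 𝕜 E]
    (φ : E →L[𝕜] 𝕜) :
    ∃ ψ : E →L[𝕜] 𝕜, IsPositive ψ ∧ ‖ψ‖ ≤ ‖φ‖ ∧ ∀ x, 0 ≤ x → ‖φ x‖ ≤ ‖ψ x‖ := by
  have := BanachLattice.isOrderedAddMonoid 𝕜 E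
  let s : ConvexCone ℝ (E × ℝ) :=
    { carrier := {z | ‖φ‖ * ‖z.1‖ < z.2}
      smul_mem' := fun c hc z hz => by
        simp only [Set.mem_ofPred_eq, Prod.smul_fst, Prod.smul_snd, norm_smul, Real.norm_eq_abs,
          abs_of_pos hc, smul_eq_mul] at hz ⊢
        nlinarith
      add_mem' := fun z hz y hy => by
        simp only [Set.mem_ofPred_eq, Prod.fst_add, Prod.snd_add] at hz hy ⊢
        have := mul_le_mul_of_nonneg_left (norm_add_le z.1 y.1) (norm_nonneg φ)
        linarith }
  let t : ConvexCone ℝ (E × ℝ) :=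
    { carrier := {z | ∃ v x : E, IsRePart 𝕜 z.1 x ∧ modulus 𝕜 v ≤ x ∧ z.2 ≤ RCLike.re (φ v)}
      smul_mem' := fun c hc z ⟨v, x, h1, h2, h3⟩ => by
        refine ⟨(c : 𝕜) • v, (c : 𝕜) • x, ?_, ?_, ?_⟩
        · rw [Prod.smul_fst, RCLike.real_smul_eq_coe_smul (K := 𝕜)]
          exact h1.real_smul c
        · refine (modulus_smul_le _ _).trans ?_
          rw [RCLike.norm_ofReal, abs_of_pos hc]
          exact real_smul_le_real_smul hc.le h2
        · simp only [map_smul, smul_eq_mul, RCLike.re_ofReal_mul, Prod.smul_snd]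
          gcongr
      add_mem' := fun z ⟨v, x, h1, h2, h3⟩ y ⟨v', x', h1', h2', h3'⟩ =>
        ⟨v + v', x + x', h1.add h1', (modulus_add_le _ _).trans (add_le_add h2 h2'), by
          simp only [map_add, Prod.snd_add]; gcongr⟩ }
  have hs : IsOpen (s : Set (E × ℝ)) :=
    isOpen_lt (continuous_const.mul continuous_fst.norm) continuous_snd
  have h0 : modulus 𝕜 (0 : E) = 0 := modulus_of_nonneg le_rfl
  have ht : (0 : E × ℝ) ∈ t := ⟨0, 0, isReal_zero.isRePart, h0.le, by simp⟩
  have hst : Disjoint (s : Set (E × ℝ)) t := by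
    rw [Set.disjoint_left]
    rintro z hz ⟨v, x, h1, h2, h3⟩
    replace hz : ‖φ‖ * ‖z.1‖ < z.2 := hz
    have h4 : ‖v‖ ≤ ‖z.1‖ := by
      rw [← norm_modulus (𝕜 := 𝕜) v]
      exact (BanachLattice.norm_le_norm 𝕜 _ _ (modulus_nonneg v) h2).trans
        (h1.norm_le ((modulus_nonneg v).trans h2))
    have h5 : RCLike.re (φ v) ≤ ‖φ‖ * ‖z.1‖ :=
      (RCLike.re_le_norm _).trans ((φ.le_opNorm v).trans (by gcongr))
    linarith
  obtain ⟨L, hL, hL'⟩ := exists_dual_separating_cones s t hs ht hst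
  have hτ : L (0, 1) < 0 := hL (0, 1) (by change ‖φ‖ * ‖(0 : E)‖ < 1; simp)
  set τ := -L (0, 1) with hτd
  have hτ0 : 0 < τ := by linarith
  let f : StrongDual ℝ E := τ⁻¹ • L.comp (ContinuousLinearMap.inl ℝ E ℝ)
  have hf : ∀ z r, L (z, r) = τ * (f z - r) := fun z r => by
    have h1 : ((z, r) : E × ℝ) = (z, 0) + r • (0, 1) := by simp
    rw [h1, map_add, map_smul, smul_eq_mul]
    simp only [f, smul_apply, ContinuousLinearMap.comp_apply,
      ContinuousLinearMap.inl_apply, smul_eq_mul]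
    field_simp
    rw [hτd]; ring
  have hf1 : ∀ z, f z ≤ ‖φ‖ * ‖z‖ := fun z => le_of_forall_pos_le_add fun ε hε => by
    have h1 := hL (z, ‖φ‖ * ‖z‖ + ε) (by change ‖φ‖ * ‖z‖ < ‖φ‖ * ‖z‖ + ε; linarith)
    rw [hf] at h1
    nlinarith
  have hf2 : ∀ z r, (z, r) ∈ t → r ≤ f z := fun z r hz => by
    have h1 := hL' _ hz
    rw [hf] at h1
    nlinarith
  have hfx : ∀ x, 0 ≤ x → ‖φ x‖ ≤ f x := fun x hx => by
    -- Rotating `x` by the phase of `φ x` leaves the modulus unchanged and makes `φ` real and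
    -- nonnegative.
    obtain ⟨c, hc, hcx⟩ := RCLike.exists_norm_eq_mul_self (φ x)
    refine hf2 _ _ ⟨c • x, x, (isReal_of_nonneg hx).isRePart, ?_, ?_⟩
    · simpa [hc, modulus_of_nonneg hx] using modulus_smul_le c x
    · rw [map_smul, smul_eq_mul, ← hcx, RCLike.ofReal_re]
  have hfI : ∀ x, 0 ≤ x → f ((RCLike.I : 𝕜) • x) = 0 := fun x hx => by
    -- For purely imaginary `c` the real part of `c • x` is `0`, so `v = 0` is admissible; `c = I`
    -- and `c = -I` together force `f (I • x) = 0`.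
    have h1 : ∀ c : 𝕜, RCLike.re c = 0 → 0 ≤ f (c • x) := fun c hc => by
      refine hf2 _ _ ⟨0, 0, ?_, h0.le, by simp⟩
      simpa [hc] using (isReal_of_nonneg hx).isRePart_smul c
    refine le_antisymm ?_ (h1 _ RCLike.I_re)
    have := h1 (-RCLike.I) (by simp)
    rw [neg_smul, map_neg] at this
    linarith
  have hext : ∀ x, 0 ≤ x → f.extendRCLike (𝕜 := 𝕜) x = (f x : 𝕜) := fun x hx => by
    rw [StrongDual.extendRCLike_apply, hfI x hx]; simp
  refine ⟨f.extendRCLike, fun x hx => ?_, ?_, fun x hx => ?_⟩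
  · rw [hext x hx]
    exact_mod_cast (norm_nonneg _).trans (hfx x hx)
  · rw [StrongDual.norm_extendRCLike]
    refine ContinuousLinearMap.opNorm_le_bound _ (norm_nonneg _) fun z => ?_
    rw [Real.norm_eq_abs, abs_le]
    have h1 := hf1 (-z)
    rw [map_neg, norm_neg] at h1
    exact ⟨by linarith, hf1 z⟩
  · rw [hext x hx, RCLike.norm_ofReal]
    exact (hfx x hx).trans (le_abs_self _)

/-- Every bounded functional is dominated on the positive cone by a positive functional of no
larger norm. -/
theorem exists_isPositive_dominating (φ : E →L[𝕜] 𝕜) :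
    ∃ ψ : E →L[𝕜] 𝕜, IsPositive ψ ∧ ‖ψ‖ ≤ ‖φ‖ ∧ ∀ x, 0 ≤ x → ‖φ x‖ ≤ ‖ψ x‖ := by
  let _ : NormedSpace ℝ E := NormedSpace.restrictScalars ℝ 𝕜 E
  have : IsScalarTower ℝ 𝕜 E := ⟨fun r c x => by
    change (r • c) • x = (algebraMap ℝ 𝕜 r) • c • x
    rw [smul_smul, Algebra.smul_def]⟩
  exact exists_isPositive_dominating_aux φ

end Domination

/-! ### Polarization, extension of multilinear maps, homogeneous polynomials -/

section Multilinear

open Finset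

/-- Inclusion-exclusion: in the expansion over index maps `r`, the signs of the sets `S` containing
the range of `r` cancel unless `r` is surjective, that is, a permutation. Only sums of the `x i`
occur on the diagonal, so positive vectors stay positive. -/
theorem sum_perm_eq_sum_neg_one_smul {R M N : Type*} [CommRing R] [AddCommGroup M] [Module R M]
    [AddCommGroup N] [Module R N] {m : ℕ} (A : MultilinearMap R (fun _ : Fin m => M) N)
    (x : Fin m → M) :
    ∑ σ : Equiv.Perm (Fin m), A (fun i => x (σ i)) =
      ∑ S : Finset (Fin m), (∏ _i ∈ univ \ S, (-1 : R)) • A (fun _ => ∑ i ∈ S, x i) := by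
  classical
  have h1 : ∀ S : Finset (Fin m), A (fun _ => ∑ i ∈ S, x i) =
      ∑ r : Fin m → Fin m, if ∀ i, r i ∈ S then A (fun i => x (r i)) else 0 := fun S => by
    rw [A.map_sum_finset (fun _ j => x j) (fun _ => S), ← sum_filter]
    congr 1
    ext r
    simp
  have h2 : ∀ r : Fin m → Fin m,
      ∑ S : Finset (Fin m), (∏ _i ∈ univ \ S, (-1 : R)) * (if ∀ i, r i ∈ S then 1 else 0) =
        if Function.Surjective r then 1 else 0 := fun r => by
    -- The signed sum is the expansion of a product whose factor at `i` is `1` if `i` lies in the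
    -- range of `r` and `1 - 1 = 0` otherwise.
    have h3 := Finset.prod_add (fun _ => (1 : R)) (fun i => if i ∈ Set.range r then (0 : R) else -1)
      (univ : Finset (Fin m))
    rw [powerset_univ] at h3
    trans ∏ i, ((1 : R) + if i ∈ Set.range r then (0 : R) else -1)
    · rw [h3]
      refine sum_congr rfl fun S _ => ?_
      rw [prod_const_one, one_mul]
      split_ifs with h
      · rw [mul_one]
        refine prod_congr rfl fun i hi => ?_
        rw [if_neg]
        rintro ⟨j, rfl⟩
        exact (mem_sdiff.1 hi).2 (h j)
      · push Not at h
        obtain ⟨j, hj⟩ := h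
        rw [mul_zero, prod_eq_zero (i := r j) (by simpa using hj) (by simp)]
    · split_ifs with h
      · exact prod_eq_one fun i _ => by rw [if_pos (Set.mem_range.2 (h i)), add_zero]
      · obtain ⟨i, hi⟩ := not_forall.1 h
        exact prod_eq_zero (mem_univ i) (by rw [if_neg (by simpa using hi), add_neg_cancel])
  have h4 : ∑ S : Finset (Fin m), (∏ _i ∈ univ \ S, (-1 : R)) • A (fun _ => ∑ i ∈ S, x i) =
      ∑ r : Fin m → Fin m, if Function.Surjective r then A (fun i => x (r i)) else 0 := by
    simp_rw [h1, smul_sum]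
    rw [sum_comm]
    refine sum_congr rfl fun r _ => ?_
    rw [show (if Function.Surjective r then A (fun i => x (r i)) else 0) =
      (if Function.Surjective r then (1 : R) else 0) • A (fun i => x (r i)) by split_ifs <;> simp,
      ← h2, sum_smul]
    refine sum_congr rfl fun S _ => ?_
    split_ifs <;> simp
  rw [h4, ← sum_filter]
  refine sum_bij (fun σ _ => ⇑σ) (fun σ _ => by simpa using σ.surjective)
    (fun σ _ τ _ h => DFunLike.coe_injective h) (fun r hr => ?_) (fun _ _ => rfl)
  have hr' : Function.Bijective r := Finite.surjective_iff_bijective.1 (by simpa using hr)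
  exact ⟨Equiv.ofBijective r hr', mem_univ _, rfl⟩

variable {𝕜 : Type w} [RCLike 𝕜]

/-- By symmetry the polarization sum is `m! • A x`; it has `2 ^ m` terms, and `m! ≥ 1` is discarded.
-/
theorem norm_le_of_norm_diagonal_le {M Y : Type*} [AddCommGroup M] [Module 𝕜 M]
    [NormedAddCommGroup Y] [NormedSpace 𝕜 Y] {m : ℕ}
    (A : MultilinearMap 𝕜 (fun _ : Fin m => M) Y)
    (hA : ∀ (σ : Equiv.Perm (Fin m)) (x : Fin m → M), A (fun i => x (σ i)) = A x)
    (x : Fin m → M) {b : ℝ} (hb : ∀ S : Finset (Fin m), ‖A (fun _ => ∑ i ∈ S, x i)‖ ≤ b) :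
    ‖A x‖ ≤ 2 ^ m * b := by
  have h1 := sum_perm_eq_sum_neg_one_smul A x
  simp only [hA, sum_const, card_univ, Fintype.card_perm, Fintype.card_fin] at h1
  have h2 : ‖m.factorial • A x‖ ≤ 2 ^ m * b := by
    rw [h1]
    refine (norm_sum_le_of_le (n := fun _ => b) _ fun S _ => ?_).trans_eq ?_
    · simpa [norm_smul] using hb S
    · simp
  rw [← Nat.cast_smul_eq_nsmul 𝕜, norm_smul, RCLike.norm_natCast] at h2
  have h3 : (1 : ℝ) ≤ m.factorial := by exact_mod_cast m.factorial_pos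
  nlinarith [norm_nonneg (A x)]

/-- Extension of a bounded multilinear map along a linear map with dense range. -/
theorem exists_continuousMultilinearMap_extension {M X : Type u} [AddCommGroup M] [Module 𝕜 M]
    [NormedAddCommGroup X] [NormedSpace 𝕜 X] (e : M →ₗ[𝕜] X) (he : DenseRange e) {m : ℕ} :
    ∀ {Y : Type u} [NormedAddCommGroup Y] [NormedSpace 𝕜 Y] [CompleteSpace Y]
    (A : MultilinearMap 𝕜 (fun _ : Fin m => M) Y) (C : ℝ),
    0 ≤ C → (∀ x, ‖A x‖ ≤ C * ∏ i, ‖e (x i)‖) →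
    ∃ B : ContinuousMultilinearMap 𝕜 (fun _ : Fin m => X) Y, ∀ x, B (fun i => e (x i)) = A x := by
  induction m with
  | zero =>
    intro Y _ _ _ A C hC hA
    exact ⟨ContinuousMultilinearMap.constOfIsEmpty 𝕜 _ (A 0), fun x => by
      rw [ContinuousMultilinearMap.constOfIsEmpty_apply, Subsingleton.elim x 0]⟩
  | succ m ih =>
    intro Y _ _ _ A C hC hA
    have hA' : ∀ x : Fin m → M, ∀ y, ‖A.curryRight x y‖ ≤ (C * ∏ i, ‖e (x i)‖) * ‖e y‖ :=
      fun x y => by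
        rw [MultilinearMap.curryRight_apply]
        refine (hA _).trans_eq ?_
        rw [Fin.prod_univ_castSucc]
        simp [mul_assoc]
    have key : ∀ x y, (A.curryRight x).extendOfNorm e (e y) = A.curryRight x y := fun x y =>
      LinearMap.extendOfNorm_eq he ⟨_, hA' x⟩ y
    have hext : ∀ f g : X →L[𝕜] Y, (∀ y, f (e y) = g (e y)) → f = g := fun f g h =>
      ContinuousLinearMap.coeFn_injective (he.equalizer f.continuous g.continuous (funext h))
    -- The last variable is extended first. This leaves a map of `m` variables into the Banach space
    -- `X →L[𝕜] Y`, to which the induction hypothesis applies with the same constant.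
    let A' : MultilinearMap 𝕜 (fun _ : Fin m => M) (X →L[𝕜] Y) :=
      { toFun := fun x => (A.curryRight x).extendOfNorm e
        map_update_add' := fun x i a b => hext _ _ fun y => by
          rw [add_apply, key, key, key, MultilinearMap.map_update_add,
            LinearMap.add_apply]
        map_update_smul' := fun x i c a => hext _ _ fun y => by
          rw [smul_apply, key, key, MultilinearMap.map_update_smul,
            LinearMap.smul_apply] }
    obtain ⟨B, hB⟩ := ih A' C hC fun x =>
      LinearMap.opNorm_extendOfNorm_le he (by positivity) (hA' x)
    refine ⟨ContinuousMultilinearMap.uncurryRight B, fun x => ?_⟩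
    rw [ContinuousMultilinearMap.uncurryRight_apply]
    change B (fun i => e (x i.castSucc)) (e (x (Fin.last m))) = A x
    rw [hB]
    change (A.curryRight _).extendOfNorm e (e _) = _
    rw [key, MultilinearMap.curryRight_apply]
    congr 1
    exact Fin.snoc_init_self x

/-- The Hausdorff completion of a module with respect to a seminorm. -/
theorem exists_completion_of_seminorm {M : Type u} [AddCommGroup M] [Module 𝕜 M]
    (ρ : Seminorm 𝕜 M) :
    ∃ (X : Type u) (_ : NormedAddCommGroup X) (_ : NormedSpace 𝕜 X) (_ : CompleteSpace X)
      (e : M →ₗ[𝕜] X), DenseRange e ∧ ∀ x, ‖e x‖ = ρ x := by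
  let _ : SeminormedAddCommGroup M := ρ.toAddGroupSeminorm.toSeminormedAddCommGroup
  let _ : NormedSpace 𝕜 M := { norm_smul_le := fun c x => (map_smul_eq_mul ρ c x).le }
  exact ⟨UniformSpace.Completion M, inferInstance, inferInstance, inferInstance,
    (UniformSpace.Completion.toComplL (𝕜 := 𝕜) (E := M)).toLinearMap,
    UniformSpace.Completion.denseRange_coe, fun x => UniformSpace.Completion.norm_coe x⟩

/-- Symmetrization does not change the diagonal, so symmetry of the form need not be checked
afterwards. -/
theorem diagonal_mem_contPoly {X Y : Type u} [NormedAddCommGroup X] [NormedSpace 𝕜 X]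
    [NormedAddCommGroup Y] [NormedSpace 𝕜 Y] {m : ℕ}
    (A : ContinuousMultilinearMap 𝕜 (fun _ : Fin m => X) Y) :
    (fun x => A fun _ => x) ∈ ContPoly 𝕜 m X Y := by
  refine ⟨(m.factorial : 𝕜)⁻¹ • ∑ σ : Equiv.Perm (Fin m), A.domDomCongr σ, fun τ x => ?_,
    fun x => ?_⟩
  · simp only [smul_apply, _root_.sum_apply,
      ContinuousMultilinearMap.domDomCongr_apply]
    congr 1
    exact Fintype.sum_equiv (Equiv.mulLeft τ) _ _ fun σ => rfl
  · simp only [smul_apply, _root_.sum_apply,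
      ContinuousMultilinearMap.domDomCongr_apply, sum_const, card_univ, Fintype.card_perm,
      Fintype.card_fin]
    rw [← Nat.cast_smul_eq_nsmul 𝕜, smul_smul, inv_mul_cancel₀, one_smul]
    exact_mod_cast m.factorial_ne_zero

variable (𝕜) in
/-- The space of continuous `m`-homogeneous polynomials as a submodule of all maps. -/
def contPolySubmodule (m : ℕ) (X Y : Type u) [NormedAddCommGroup X] [NormedSpace 𝕜 X]
    [NormedAddCommGroup Y] [NormedSpace 𝕜 Y] : Submodule 𝕜 (X → Y) where
  carrier := ContPoly 𝕜 m X Y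
  zero_mem' := diagonal_mem_contPoly 0
  add_mem' := by
    rintro P Q ⟨A, -, hA⟩ ⟨B, -, hB⟩
    rw [show P + Q = fun x => (A + B) fun _ => x from funext fun x => by simp [hA, hB]]
    exact diagonal_mem_contPoly _
  smul_mem' := by
    rintro c P ⟨A, -, hA⟩
    rw [show c • P = fun x => (c • A) fun _ => x from funext fun x => by simp [hA]]
    exact diagonal_mem_contPoly _

theorem contPoly_comp {X Y Z W : Type u} [NormedAddCommGroup X] [NormedSpace 𝕜 X]
    [NormedAddCommGroup Y] [NormedSpace 𝕜 Y] [NormedAddCommGroup Z] [NormedSpace 𝕜 Z]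
    [NormedAddCommGroup W] [NormedSpace 𝕜 W] {m : ℕ} {P : X → Y} (hP : P ∈ ContPoly 𝕜 m X Y)
    (u : W →L[𝕜] X) (v : Y →L[𝕜] Z) : (fun x => v (P (u x))) ∈ ContPoly 𝕜 m W Z := by
  obtain ⟨A, -, hA⟩ := hP
  rw [show (fun x => v (P (u x))) = fun x =>
    v.compContinuousMultilinearMap (A.compContinuousLinearMap fun _ => u) fun _ => x from
    funext fun x => by simp [hA]]
  exact diagonal_mem_contPoly _

theorem exists_norm_le_of_mem_contPoly {X Y : Type u} [NormedAddCommGroup X] [NormedSpace 𝕜 X]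
    [NormedAddCommGroup Y] [NormedSpace 𝕜 Y] {m : ℕ} {P : X → Y} (hP : P ∈ ContPoly 𝕜 m X Y) :
    ∃ C : ℝ, 0 ≤ C ∧ ∀ x, ‖P x‖ ≤ C * ‖x‖ ^ m := by
  obtain ⟨A, -, hA⟩ := hP
  exact ⟨‖A‖, norm_nonneg _, fun x => by simpa [hA] using A.le_opNorm fun _ => x⟩

variable (𝕜) in
theorem pow_smul_mem_contPoly {X Y : Type u} [NormedAddCommGroup X] [NormedSpace 𝕜 X]
    [NormedAddCommGroup Y] [NormedSpace 𝕜 Y] (m : ℕ) (φ : X →L[𝕜] 𝕜) (y : Y) :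
    (fun x => φ x ^ m • y) ∈ ContPoly 𝕜 m X Y := by
  rw [show (fun x => φ x ^ m • y) = fun x => ((ContinuousMultilinearMap.mkPiRing 𝕜 (Fin m)
    y).compContinuousLinearMap fun _ => φ) fun _ => x from funext fun x => by simp]
  exact diagonal_mem_contPoly _

end Multilinear

/-! ### Suprema and real powers -/

open scoped BoundedContinuousFunction

theorem ciSup_rpow {ι : Type*} [Nonempty ι] {f : ι → ℝ} (h0 : ∀ i, 0 ≤ f i)
    (hf : BddAbove (Set.range f)) {r : ℝ} (hr : 0 < r) : ⨆ i, f i ^ r = (⨆ i, f i) ^ r := by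
  have h1 : ∀ i, f i ^ r ≤ (⨆ i, f i) ^ r := fun i =>
    Real.rpow_le_rpow (h0 i) (le_ciSup hf i) hr.le
  have hbdd : BddAbove (Set.range fun i => f i ^ r) := ⟨_, Set.forall_mem_range.2 h1⟩
  refine le_antisymm (ciSup_le h1) ?_
  have h2 : ∀ i, f i ≤ (⨆ i, f i ^ r) ^ (1 / r) := fun i =>
    calc f i = (f i ^ r) ^ (1 / r) := by
          rw [← Real.rpow_mul (h0 i), mul_one_div_cancel hr.ne', Real.rpow_one]
      _ ≤ _ := Real.rpow_le_rpow (Real.rpow_nonneg (h0 i) _) (le_ciSup hbdd i) (by positivity)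
  calc (⨆ i, f i) ^ r ≤ ((⨆ i, f i ^ r) ^ (1 / r)) ^ r :=
        Real.rpow_le_rpow (Real.iSup_nonneg h0) (ciSup_le h2) hr.le
    _ = _ := by
        rw [← Real.rpow_mul (Real.iSup_nonneg fun i => Real.rpow_nonneg (h0 i) _),
          one_div_mul_cancel hr.ne', Real.rpow_one]

/-- This removes the outer exponents `1 / p` and `m / p` from the two definitions. -/
theorem exists_rpow_le_mul_rpow_iff {α : ℕ → Type*} {H : ∀ n, α n → Prop} {a b : ∀ n, α n → ℝ}
    (ha : ∀ n x, 0 ≤ a n x) (hb : ∀ n x, 0 ≤ b n x) {r : ℝ} (hr : 0 < r) :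
    (∃ C : ℝ, 0 < C ∧ ∀ n x, H n x → a n x ^ r ≤ C * b n x ^ r) ↔
      ∃ C : ℝ, 0 < C ∧ ∀ n x, H n x → a n x ≤ C * b n x := by
  constructor
  · rintro ⟨C, hC, h⟩
    refine ⟨C ^ (1 / r), by positivity, fun n x hx => ?_⟩
    have h1 := Real.rpow_le_rpow (Real.rpow_nonneg (ha n x) _) (h n x hx) (z := 1 / r)
      (by positivity)
    rwa [Real.mul_rpow hC.le (Real.rpow_nonneg (hb n x) _), ← Real.rpow_mul (ha n x),
      ← Real.rpow_mul (hb n x), mul_one_div_cancel hr.ne', Real.rpow_one, Real.rpow_one] at h1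
  · rintro ⟨C, hC, h⟩
    refine ⟨C ^ r, by positivity, fun n x hx => ?_⟩
    rw [← Real.mul_rpow hC.le (hb n x)]
    exact Real.rpow_le_rpow (ha n x) (h n x hx) hr.le

/-- The exponent `p / m` may be below `1`, so a quasi-triangle inequality valid for every `q > 0` is
used. -/
theorem add_rpow_le_two_rpow_mul {a b q : ℝ} (ha : 0 ≤ a) (hb : 0 ≤ b) (hq : 0 < q) :
    (a + b) ^ q ≤ 2 ^ q * (a ^ q + b ^ q) := by
  have ha' := Real.rpow_nonneg ha q
  have hb' := Real.rpow_nonneg hb q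
  rcases le_total a b with h | h
  · calc (a + b) ^ q ≤ (2 * b) ^ q := Real.rpow_le_rpow (by positivity) (by linarith) hq.le
      _ = 2 ^ q * b ^ q := Real.mul_rpow (by norm_num) hb
      _ ≤ _ := by gcongr; linarith
  · calc (a + b) ^ q ≤ (2 * a) ^ q := Real.rpow_le_rpow (by positivity) (by linarith) hq.le
      _ = 2 ^ q * a ^ q := Real.mul_rpow (by norm_num) ha
      _ ≤ _ := by gcongr; linarith

/-! ### Weak suprema over positive functionals and the common domination condition -/

section WeakSup

variable {𝕜 : Type w} [RCLike 𝕜] {E : Type u} [NormedAddCommGroup E] [NormedSpace 𝕜 E]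
  [PartialOrder E]

instance : Nonempty (positiveDualBall 𝕜 E) :=
  ⟨⟨0, by simp, fun x _ => by simp⟩⟩

variable (𝕜) in
/-- The supremum of `∑ |φ (x i)|^p` over the positive functionals in the dual unit ball. -/
noncomputable def positiveWeakSup (p : ℝ) {n : ℕ} (x : Fin n → E) : ℝ :=
  ⨆ φ : positiveDualBall 𝕜 E, ∑ i, ‖φ.1 (x i)‖ ^ p

theorem norm_apply_le_of_mem (φ : positiveDualBall 𝕜 E) (x : E) : ‖φ.1 x‖ ≤ ‖x‖ := by
  simpa using φ.1.le_of_opNorm_le φ.2.1 x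

theorem sum_rpow_nonneg {n : ℕ} (a : Fin n → ℝ) (ha : ∀ i, 0 ≤ a i) (p : ℝ) :
    0 ≤ ∑ i, a i ^ p := Finset.sum_nonneg fun i _ => Real.rpow_nonneg (ha i) _

theorem bddAbove_positiveWeakSup {p : ℝ} (hp : 0 ≤ p) {n : ℕ} (x : Fin n → E) :
    BddAbove (Set.range fun φ : positiveDualBall 𝕜 E => ∑ i, ‖φ.1 (x i)‖ ^ p) :=
  ⟨∑ i, ‖x i‖ ^ p, Set.forall_mem_range.2 fun φ => Finset.sum_le_sum fun _ _ =>
    Real.rpow_le_rpow (norm_nonneg _) (norm_apply_le_of_mem φ _) hp⟩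

theorem le_positiveWeakSup {p : ℝ} (hp : 0 ≤ p) {n : ℕ} (x : Fin n → E)
    (φ : positiveDualBall 𝕜 E) : ∑ i, ‖φ.1 (x i)‖ ^ p ≤ positiveWeakSup 𝕜 p x :=
  le_ciSup (bddAbove_positiveWeakSup hp x) φ

theorem positiveWeakSup_nonneg (p : ℝ) {n : ℕ} (x : Fin n → E) : 0 ≤ positiveWeakSup 𝕜 p x :=
  Real.iSup_nonneg fun _ => sum_rpow_nonneg _ (fun _ => norm_nonneg _) _

theorem iSup_sum_rpow {p : ℝ} (hp : 0 ≤ p) {n : ℕ} (x : Fin n → E) {r : ℝ} (hr : 0 < r) :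
    ⨆ φ : positiveDualBall 𝕜 E, (∑ i, ‖φ.1 (x i)‖ ^ p) ^ r = positiveWeakSup 𝕜 p x ^ r :=
  ciSup_rpow (f := fun φ : positiveDualBall 𝕜 E => ∑ i, ‖φ.1 (x i)‖ ^ p)
    (fun φ => sum_rpow_nonneg (fun i => ‖φ.1 (x i)‖) (fun _ => norm_nonneg _) p)
    (bddAbove_positiveWeakSup hp x) hr

theorem sum_norm_rpow_le_of_isPositive {p : ℝ} (hp : 0 ≤ p) {n : ℕ} (x : Fin n → E)
    {ψ : E →L[𝕜] 𝕜} (hψ : IsPositive ψ) {M : ℝ} (hM : 0 < M) (hψM : ‖ψ‖ ≤ M) :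
    ∑ i, ‖ψ (x i)‖ ^ p ≤ M ^ p * positiveWeakSup 𝕜 p x := by
  have hmem : ((M⁻¹ : ℝ) : 𝕜) • ψ ∈ positiveDualBall 𝕜 E := by
    refine ⟨?_, fun y hy => ?_⟩
    · rw [norm_smul, RCLike.norm_ofReal, abs_of_pos (inv_pos.2 hM), inv_mul_le_one₀ hM]
      exact hψM
    · rw [smul_apply, smul_eq_mul]
      exact mul_nonneg (by exact_mod_cast (inv_pos.2 hM).le) (hψ y hy)
  have h1 := le_positiveWeakSup hp x ⟨_, hmem⟩
  calc ∑ i, ‖ψ (x i)‖ ^ p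
      = M ^ p * ∑ i, ‖(((M⁻¹ : ℝ) : 𝕜) • ψ) (x i)‖ ^ p := by
        rw [Finset.mul_sum]
        refine Finset.sum_congr rfl fun i _ => ?_
        rw [← Real.mul_rpow hM.le (norm_nonneg _), smul_apply, norm_smul, RCLike.norm_ofReal,
          abs_of_pos (inv_pos.2 hM), mul_inv_cancel_left₀ hM.ne']
    _ ≤ _ := by gcongr

/-- Replacing each functional by a positive dominating one in the unit ball does not decrease the
sums at positive vectors. -/
theorem weakNorm_eq_positiveWeakSup_rpow [BanachLattice 𝕜 E] {p : ℝ} (hp : 0 < p) {n : ℕ}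
    {x : Fin n → E} (hx : ∀ i, 0 ≤ x i) :
    weakNorm 𝕜 p x = positiveWeakSup 𝕜 p x ^ (1 / p) := by
  have h1 : ∀ φ : Metric.closedBall (0 : E →L[𝕜] 𝕜) 1,
      (∑ i, ‖φ.1 (x i)‖ ^ p) ^ (1 / p) ≤ positiveWeakSup 𝕜 p x ^ (1 / p) := fun φ => by
    obtain ⟨ψ, h1, h2, h3⟩ := exists_isPositive_dominating φ.1
    refine Real.rpow_le_rpow (sum_rpow_nonneg _ (fun _ => norm_nonneg _) _)
      (le_trans (Finset.sum_le_sum fun i _ => ?_)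
        (le_positiveWeakSup hp.le x ⟨ψ, h2.trans (mem_closedBall_zero_iff.1 φ.2), h1⟩))
      (by positivity)
    exact Real.rpow_le_rpow (norm_nonneg _) (h3 _ (hx i)) hp.le
  have : Nonempty (Metric.closedBall (0 : E →L[𝕜] 𝕜) 1) := ⟨⟨0, by simp⟩⟩
  refine le_antisymm (ciSup_le h1) ?_
  rw [← iSup_sum_rpow hp.le x (by positivity)]
  exact ciSup_le fun φ => le_ciSup (f := fun φ : Metric.closedBall (0 : E →L[𝕜] 𝕜) 1 =>
    (∑ i, ‖φ.1 (x i)‖ ^ p) ^ (1 / p)) ⟨_, Set.forall_mem_range.2 h1⟩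
    ⟨φ.1, mem_closedBall_zero_iff.2 φ.2.1⟩

variable {Y : Type u} [NormedAddCommGroup Y] [NormedSpace 𝕜 Y]

variable (𝕜 E Y) in
/-- The maps `f` with `∑ ‖f (x i)‖^q ≤ C sup_φ ∑ |φ (x i)|^p` on finite positive sequences. -/
def dominatedSubmodule (p : ℝ) {q : ℝ} (hq : 0 < q) : Submodule 𝕜 (E → Y) where
  carrier := {f | ∃ C : ℝ, 0 < C ∧ ∀ (n : ℕ) (x : Fin n → E), (∀ i, 0 ≤ x i) →
    ∑ i, ‖f (x i)‖ ^ q ≤ C * positiveWeakSup 𝕜 p x}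
  zero_mem' := ⟨1, one_pos, fun n x _ => by
    simpa [Real.zero_rpow hq.ne'] using positiveWeakSup_nonneg p x⟩
  add_mem' := by
    rintro f g ⟨C, hC, hf⟩ ⟨D, hD, hg⟩
    refine ⟨2 ^ q * (C + D), by positivity, fun n x hx => ?_⟩
    calc ∑ i, ‖(f + g) (x i)‖ ^ q
        ≤ ∑ i, 2 ^ q * (‖f (x i)‖ ^ q + ‖g (x i)‖ ^ q) := Finset.sum_le_sum fun i _ =>
          (Real.rpow_le_rpow (norm_nonneg _) (norm_add_le _ _) hq.le).trans
            (add_rpow_le_two_rpow_mul (norm_nonneg _) (norm_nonneg _) hq)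
      _ = 2 ^ q * (∑ i, ‖f (x i)‖ ^ q + ∑ i, ‖g (x i)‖ ^ q) := by
          rw [← Finset.mul_sum, Finset.sum_add_distrib]
      _ ≤ 2 ^ q * (C * positiveWeakSup 𝕜 p x + D * positiveWeakSup 𝕜 p x) := by
          gcongr
          · exact hf n x hx
          · exact hg n x hx
      _ = _ := by ring
  smul_mem' := by
    rintro c f ⟨C, hC, hf⟩
    refine ⟨(‖c‖ + 1) ^ q * C, by positivity, fun n x hx => ?_⟩
    calc ∑ i, ‖(c • f) (x i)‖ ^ q
        ≤ ∑ i, (‖c‖ + 1) ^ q * ‖f (x i)‖ ^ q := Finset.sum_le_sum fun i _ => by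
          rw [Pi.smul_apply, norm_smul, Real.mul_rpow (norm_nonneg _) (norm_nonneg _)]
          gcongr
          linarith
      _ = (‖c‖ + 1) ^ q * ∑ i, ‖f (x i)‖ ^ q := by rw [← Finset.mul_sum]
      _ ≤ (‖c‖ + 1) ^ q * (C * positiveWeakSup 𝕜 p x) := by gcongr; exact hf n x hx
      _ = _ := by ring

theorem mem_dominatedSubmodule {p q : ℝ} (hq : 0 < q) {f : E → Y} :
    f ∈ dominatedSubmodule 𝕜 E Y p hq ↔ ∃ C : ℝ, 0 < C ∧ ∀ (n : ℕ) (x : Fin n → E),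
      (∀ i, 0 ≤ x i) → ∑ i, ‖f (x i)‖ ^ q ≤ C * positiveWeakSup 𝕜 p x := Iff.rfl

theorem mem_dominatedSubmodule_of_le {Z : Type*} [NormedAddCommGroup Z]
    {p q r : ℝ} (hr : 0 < r) {f : E → Z} {g : E → Y} {D : ℝ} (hD : 0 ≤ D)
    (hf : ∃ C : ℝ, 0 < C ∧ ∀ (n : ℕ) (x : Fin n → E),
      (∀ i, 0 ≤ x i) → ∑ i, ‖f (x i)‖ ^ q ≤ C * positiveWeakSup 𝕜 p x)
    (h : ∀ x, 0 ≤ x → ‖g x‖ ^ r ≤ D * ‖f x‖ ^ q) : g ∈ dominatedSubmodule 𝕜 E Y p hr := by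
  obtain ⟨C, hC, hf⟩ := hf
  refine ⟨(D + 1) * C, by positivity, fun n x hx => ?_⟩
  calc ∑ i, ‖g (x i)‖ ^ r ≤ ∑ i, (D + 1) * ‖f (x i)‖ ^ q := Finset.sum_le_sum fun i _ =>
        (h _ (hx i)).trans (by gcongr; linarith)
    _ = (D + 1) * ∑ i, ‖f (x i)‖ ^ q := by rw [Finset.mul_sum]
    _ ≤ (D + 1) * (C * positiveWeakSup 𝕜 p x) := by gcongr; exact hf n x hx
    _ = _ := by ring

theorem exists_sum_norm_functional_le [BanachLattice 𝕜 E] {p : ℝ} (hp : 0 ≤ p) (φ : E →L[𝕜] 𝕜) :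
    ∃ C : ℝ, 0 < C ∧ ∀ (n : ℕ) (x : Fin n → E),
      (∀ i, 0 ≤ x i) → ∑ i, ‖φ (x i)‖ ^ p ≤ C * positiveWeakSup 𝕜 p x := by
  obtain ⟨ψ, h1, -, h3⟩ := exists_isPositive_dominating φ
  refine ⟨(‖ψ‖ + 1) ^ p, by positivity, fun n x hx => ?_⟩
  exact (Finset.sum_le_sum fun i _ => Real.rpow_le_rpow (norm_nonneg _) (h3 _ (hx i)) hp).trans
    (sum_norm_rpow_le_of_isPositive hp x h1 (by positivity) (by linarith))

theorem mem_dominatedSubmodule_comp {G : Type u} [NormedAddCommGroup G] [NormedSpace 𝕜 G]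
    [PartialOrder G] {p q : ℝ} (hp : 0 ≤ p) (hq : 0 < q) {f : E → Y}
    (hf : f ∈ dominatedSubmodule 𝕜 E Y p hq) {u : G →L[𝕜] E} (hu : IsPositive u) :
    (fun x => f (u x)) ∈ dominatedSubmodule 𝕜 G Y p hq := by
  obtain ⟨C, hC, hf⟩ := hf
  refine ⟨C * (‖u‖ + 1) ^ p, by positivity, fun n x hx => ?_⟩
  have h1 : positiveWeakSup 𝕜 p (fun i => u (x i)) ≤ (‖u‖ + 1) ^ p * positiveWeakSup 𝕜 p x :=
    ciSup_le fun φ => by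
      refine sum_norm_rpow_le_of_isPositive hp x (ψ := φ.1.comp u)
        (fun y hy => φ.2.2 _ (hu y hy)) (by positivity) ?_
      calc ‖φ.1.comp u‖ ≤ ‖φ.1‖ * ‖u‖ := ContinuousLinearMap.opNorm_comp_le _ _
        _ ≤ 1 * ‖u‖ := by gcongr; exact φ.2.1
        _ ≤ ‖u‖ + 1 := by linarith
  calc ∑ i, ‖f (u (x i))‖ ^ q ≤ C * positiveWeakSup 𝕜 p (fun i => u (x i)) :=
        hf n _ fun i => hu _ (hx i)
    _ ≤ C * ((‖u‖ + 1) ^ p * positiveWeakSup 𝕜 p x) := by gcongr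
    _ = _ := by ring

theorem mem_positiveSumming_iff [BanachLattice 𝕜 E] [CompleteSpace Y] {p : ℝ} (hp : 0 < p)
    {T : E →L[𝕜] Y} :
    T ∈ PositiveSumming 𝕜 p E Y ↔ (T : E → Y) ∈ dominatedSubmodule 𝕜 E Y p hp := by
  rw [mem_dominatedSubmodule, ← exists_rpow_le_mul_rpow_iff (r := 1 / p)
    (fun n x => sum_rpow_nonneg _ (fun _ => norm_nonneg _) _)
    (fun n x => positiveWeakSup_nonneg _ _) (by positivity)]
  refine exists_congr fun C => and_congr_right fun _ => forall_congr' fun n =>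
    forall_congr' fun x => forall_congr' fun hx => ?_
  rw [weakNorm_eq_positiveWeakSup_rpow hp hx]

theorem mem_positiveDominated_iff [BanachLattice 𝕜 E] [CompleteSpace Y] {m : ℕ} {p : ℝ}
    (hp : 0 < p) (hm : 0 < (m : ℝ)) {P : E → Y} :
    P ∈ PositiveDominated 𝕜 m p E Y ↔ P ∈ ContPoly 𝕜 m E Y ∧
      P ∈ dominatedSubmodule 𝕜 E Y p (div_pos hp hm) := by
  rw [mem_dominatedSubmodule, ← exists_rpow_le_mul_rpow_iff (r := m / p)
    (a := fun n (x : Fin n → E) => ∑ i, ‖P (x i)‖ ^ (p / m))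
    (fun n x => sum_rpow_nonneg (fun i => ‖P (x i)‖) (fun _ => norm_nonneg _) _)
    (fun n x => positiveWeakSup_nonneg _ _) (by positivity)]
  simp only [PositiveDominated, Set.mem_ofPred_eq, iSup_sum_rpow hp.le _ (div_pos hm hp)]

theorem rpow_div_natCast_pow {a p : ℝ} {m : ℕ} (ha : 0 ≤ a) (hm : 0 < (m : ℝ)) :
    (a ^ m) ^ (p / m) = a ^ p := by
  rw [← Real.rpow_natCast, ← Real.rpow_mul ha, mul_div_cancel₀ _ hm.ne']

end WeakSup

open scoped BoundedContinuousFunction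

/-! ### Pietsch domination and factorization -/

section Pietsch

variable {𝕜 : Type w} [RCLike 𝕜] {E : Type u} [NormedAddCommGroup E] [NormedSpace 𝕜 E]
  [PartialOrder E]

variable (𝕜) in
/-- The function `φ ↦ |φ(x)|^p` on the positive part of the dual unit ball. -/
noncomputable def evalRpow {p : ℝ} (hp : 0 ≤ p) (x : E) : positiveDualBall 𝕜 E →ᵇ ℝ :=
  BoundedContinuousFunction.ofNormedAddCommGroup (fun φ => ‖φ.1 x‖ ^ p)
    (((ContinuousLinearMap.apply 𝕜 𝕜 x).continuous.comp continuous_subtype_val).norm.rpow_const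
      fun _ => Or.inr hp) (‖x‖ ^ p) fun φ => by
    rw [Real.norm_eq_abs, abs_of_nonneg (Real.rpow_nonneg (norm_nonneg _) _)]
    exact Real.rpow_le_rpow (norm_nonneg _) (norm_apply_le_of_mem φ x) hp

theorem evalRpow_apply {p : ℝ} (hp : 0 ≤ p) (x : E) (φ : positiveDualBall 𝕜 E) :
    evalRpow 𝕜 hp x φ = ‖φ.1 x‖ ^ p := rfl

theorem evalRpow_nonneg {p : ℝ} (hp : 0 ≤ p) (x : E) (φ : positiveDualBall 𝕜 E) :
    0 ≤ evalRpow 𝕜 hp x φ := Real.rpow_nonneg (norm_nonneg _) _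

theorem norm_real_smul_rpow {X : Type*} [NormedAddCommGroup X] [NormedSpace 𝕜 X] {c : ℝ}
    (hc : 0 ≤ c) (x : X) (p : ℝ) : ‖(c : 𝕜) • x‖ ^ p = c ^ p * ‖x‖ ^ p := by
  rw [norm_smul, RCLike.norm_ofReal, abs_of_nonneg hc, Real.mul_rpow hc (norm_nonneg _)]

theorem norm_real_smul_rpow_div_of_mem_contPoly {X Y : Type u} [NormedAddCommGroup X]
    [NormedSpace 𝕜 X] [NormedAddCommGroup Y] [NormedSpace 𝕜 Y] {m : ℕ}
    (hm : 0 < (m : ℝ)) {P : X → Y} (hP : P ∈ ContPoly 𝕜 m X Y) {c : ℝ} (hc : 0 ≤ c)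
    (x : X) (p : ℝ) : ‖P ((c : 𝕜) • x)‖ ^ (p / m) = c ^ p * ‖P x‖ ^ (p / m) := by
  obtain ⟨A, -, hA⟩ := hP
  have h1 := A.map_smul_univ (fun _ => (c : 𝕜)) (fun _ => x)
  rw [hA, h1, Finset.prod_const, Finset.card_univ, Fintype.card_fin, ← hA, norm_smul, norm_pow,
    RCLike.norm_ofReal, abs_of_nonneg hc, Real.mul_rpow (by positivity) (norm_nonneg _),
    rpow_div_natCast_pow hc hm]

variable [BanachLattice 𝕜 E]

theorem norm_apply_mono (φ : positiveDualBall 𝕜 E) {x y : E} (hx : 0 ≤ x) (hxy : x ≤ y) :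
    ‖φ.1 x‖ ≤ ‖φ.1 y‖ := by
  have := BanachLattice.isOrderedAddMonoid 𝕜 E
  obtain ⟨r, hr, h1⟩ := RCLike.nonneg_iff_exists_ofReal.1 (φ.2.2 x hx)
  obtain ⟨s, hs, h2⟩ := RCLike.nonneg_iff_exists_ofReal.1 (φ.2.2 (y - x) (sub_nonneg.2 hxy))
  have h3 : φ.1 y = ((r + s : ℝ) : 𝕜) := by
    rw [RCLike.ofReal_add, h1, h2, ← map_add, add_sub_cancel]
  rw [h3, ← h1, RCLike.norm_ofReal, RCLike.norm_ofReal, abs_of_nonneg hr,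
    abs_of_nonneg (add_nonneg hr hs)]
  linarith

theorem norm_apply_add_le (φ : positiveDualBall 𝕜 E) (z w : E) :
    ‖φ.1 (modulus 𝕜 (z + w))‖ ≤ ‖φ.1 (modulus 𝕜 z)‖ + ‖φ.1 (modulus 𝕜 w)‖ := by
  refine (norm_apply_mono φ (modulus_nonneg _) (modulus_add_le z w)).trans ?_
  rw [map_add]
  exact norm_add_le _ _

/-- Domination theorem of Pietsch type: a positive normalized functional on bounded functions
replaces the measure. -/
theorem exists_functional_of_dominated {Y : Type u} [NormedAddCommGroup Y] [NormedSpace 𝕜 Y]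
    {m : ℕ} (hm : 0 < (m : ℝ)) {p : ℝ} (hp : 0 < p) {P : E → Y} (hP : P ∈ ContPoly 𝕜 m E Y)
    (hPd : P ∈ dominatedSubmodule 𝕜 E Y p (div_pos hp hm)) :
    ∃ (L : (positiveDualBall 𝕜 E →ᵇ ℝ) →ₗ[ℝ] ℝ) (C : ℝ), (∀ f, (∀ φ, 0 ≤ f φ) → 0 ≤ L f) ∧
      L 1 = 1 ∧ 0 < C ∧ ∀ x, 0 ≤ x → ‖P x‖ ^ (p / m) ≤ C * L (evalRpow 𝕜 hp.le x) := by
  obtain ⟨C, hC, hPC⟩ := hPd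
  let g : E → (positiveDualBall 𝕜 E →ᵇ ℝ) := fun x =>
    ‖P x‖ ^ (p / m) • (1 : positiveDualBall 𝕜 E →ᵇ ℝ) - C • evalRpow 𝕜 hp.le x
  have hg : ∀ x φ, g x φ = ‖P x‖ ^ (p / m) - C * ‖φ.1 x‖ ^ p := fun x φ => by
    simp [g, evalRpow_apply]
  -- Finite sums of the `g x` already form a convex cone: concatenation gives sums, and `c • g x = g
  -- (c ^ (1 / p) • x)` since both terms of `g` have degree `p`.
  let t : ConvexCone ℝ (positiveDualBall 𝕜 E →ᵇ ℝ) :=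
    { carrier := {f | ∃ (n : ℕ) (x : Fin n → E), (∀ i, 0 ≤ x i) ∧ f = ∑ i, g (x i)}
      smul_mem' := by
        rintro c hc f ⟨n, x, hx, rfl⟩
        refine ⟨n, fun i => ((c ^ (1 / p) : ℝ) : 𝕜) • x i, fun i =>
          BanachLattice.smul_nonneg _ _ (by positivity) (hx i), ?_⟩
        rw [Finset.smul_sum]
        refine Finset.sum_congr rfl fun i _ => ?_
        ext φ
        change c * g (x i) φ = g (((c ^ (1 / p) : ℝ) : 𝕜) • x i) φ
        rw [hg, hg, map_smul,
          norm_real_smul_rpow_div_of_mem_contPoly hm hP (by positivity),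
          norm_real_smul_rpow (by positivity),
          ← Real.rpow_mul hc.le, one_div_mul_cancel hp.ne', Real.rpow_one]
        ring
      add_mem' := by
        rintro f ⟨n, x, hx, rfl⟩ f' ⟨n', x', hx', rfl⟩
        refine ⟨n + n', Fin.append x x', fun i => ?_, ?_⟩
        · refine Fin.addCases (fun i => ?_) (fun i => ?_) i
          · simpa using hx i
          · simpa using hx' i
        · simp [Fin.sum_univ_add] }
  have ht0 : (0 : positiveDualBall 𝕜 E →ᵇ ℝ) ∈ t := ⟨0, Fin.elim0, fun i => i.elim0, by simp⟩
  obtain ⟨L, hL, hL1, hLt⟩ := exists_positive_functional_nonpos t ht0 (by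
    rintro f ⟨n, x, hx, rfl⟩ ε hε
    -- If the sum were at least `ε` at every `φ`, the domination inequality would fail by `ε`.
    -- Nearly attaining the infimum suffices, so no compactness is needed.
    by_contra! hcon
    have h1 : positiveWeakSup 𝕜 p x ≤ (∑ i, ‖P (x i)‖ ^ (p / m) - ε) / C := ciSup_le fun φ => by
      have h2 := hcon φ
      simp only [BoundedContinuousFunction.coe_sum, Finset.sum_apply, hg, Finset.sum_sub_distrib,
        ← Finset.mul_sum] at h2
      rw [le_div_iff₀ hC]
      linarith
    rw [le_div_iff₀ hC] at h1
    linarith [hPC n x hx])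
  refine ⟨L, C, hL, hL1, hC, fun x hx => ?_⟩
  have h1 := hLt (g x) ⟨1, fun _ => x, fun _ => hx, by simp⟩
  simp only [g, map_sub, map_smul, hL1, smul_eq_mul, mul_one] at h1
  linarith

/-- The seminorm is the `L^p` seminorm of `φ ↦ |φ |z||` with `L` as integral. Inserting the modulus
makes it monotone; Minkowski's inequality for `L` gives subadditivity. -/
theorem exists_seminorm_of_dominated {Y : Type u} [NormedAddCommGroup Y] [NormedSpace 𝕜 Y]
    {m : ℕ} (hm : 0 < (m : ℝ)) {p : ℝ} (hp : 1 ≤ p) {P : E → Y} (hP : P ∈ ContPoly 𝕜 m E Y)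
    (hPd : P ∈ dominatedSubmodule 𝕜 E Y p (div_pos (by linarith) hm)) :
    ∃ (ρ : Seminorm 𝕜 E) (C : ℝ), 0 ≤ C ∧ (∀ z, ρ z ≤ ‖z‖) ∧
      (∀ a z, 0 ≤ a → a ≤ modulus 𝕜 z → ρ a ≤ ρ z) ∧
      (∀ (n : ℕ) (x : Fin n → E), (∀ i, 0 ≤ x i) → ∑ i, ρ (x i) ^ p ≤ positiveWeakSup 𝕜 p x) ∧
      ∀ x, 0 ≤ x → ‖P x‖ ≤ C * ρ x ^ m := by
  have hp0 : 0 < p := by linarith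
  obtain ⟨L, C, hL, hL1, hC, hLP⟩ := exists_functional_of_dominated hm hp0 hP hPd
  have hmono : ∀ f g, (∀ φ, f φ ≤ g φ) → L f ≤ L g := fun f g h => by
    rw [← sub_nonneg, ← map_sub]
    exact hL _ fun φ => sub_nonneg.2 (h φ)
  have hnn : ∀ x, 0 ≤ L (evalRpow 𝕜 hp0.le x) := fun x => hL _ (evalRpow_nonneg _ x)
  have hinv : ∀ {r : ℝ}, 0 ≤ r → (r ^ p) ^ (1 / p) = r := fun {r} hr => by
    rw [← Real.rpow_mul hr, mul_one_div_cancel hp0.ne', Real.rpow_one]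
  have hinv' : ∀ {r : ℝ}, 0 ≤ r → (r ^ (1 / p)) ^ p = r := fun {r} hr => by
    rw [← Real.rpow_mul hr, one_div_mul_cancel hp0.ne', Real.rpow_one]
  have h00 : modulus 𝕜 (0 : E) = 0 := modulus_of_nonneg le_rfl
  have hsmul : ∀ (c : 𝕜) (z : E), L (evalRpow 𝕜 hp0.le (modulus 𝕜 (c • z))) ^ (1 / p) ≤
      ‖c‖ * L (evalRpow 𝕜 hp0.le (modulus 𝕜 z)) ^ (1 / p) := fun c z => by
    have h1 : L (evalRpow 𝕜 hp0.le (modulus 𝕜 (c • z))) ≤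
        ‖c‖ ^ p * L (evalRpow 𝕜 hp0.le (modulus 𝕜 z)) := by
      rw [← smul_eq_mul, ← map_smul]
      refine hmono _ _ fun φ => ?_
      change ‖φ.1 (modulus 𝕜 (c • z))‖ ^ p ≤ ‖c‖ ^ p * ‖φ.1 (modulus 𝕜 z)‖ ^ p
      rw [← norm_real_smul_rpow (𝕜 := 𝕜) (norm_nonneg c), ← map_smul]
      exact Real.rpow_le_rpow (norm_nonneg _)
        (norm_apply_mono φ (modulus_nonneg _) (modulus_smul_le c z)) hp0.le
    refine (Real.rpow_le_rpow (hnn _) h1 (by positivity)).trans_eq ?_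
    rw [Real.mul_rpow (by positivity) (hnn _), hinv (norm_nonneg _)]
  let ρ : Seminorm 𝕜 E := Seminorm.ofSMulLE
    (fun z => L (evalRpow 𝕜 hp0.le (modulus 𝕜 z)) ^ (1 / p))
    (by
      have h1 : evalRpow 𝕜 hp0.le (0 : E) = 0 := by
        ext φ; simp [evalRpow_apply, Real.zero_rpow hp0.ne']
      simp [h00, h1, Real.zero_rpow (inv_ne_zero hp0.ne')])
    (fun z w => rpow_functional_le_add hp L hL _ _ _ (fun φ => ‖φ.1 (modulus 𝕜 z)‖)
      (fun φ => ‖φ.1 (modulus 𝕜 w)‖) (fun _ => norm_nonneg _) (fun _ => norm_nonneg _)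
      (fun _ => rfl) (fun _ => rfl)
      (fun φ => Real.rpow_le_rpow (norm_nonneg _) (norm_apply_add_le φ z w) hp0.le)
      (evalRpow_nonneg _ _))
    hsmul
  have hρ : ∀ z, ρ z = L (evalRpow 𝕜 hp0.le (modulus 𝕜 z)) ^ (1 / p) := fun _ => rfl
  have hρ' : ∀ x, 0 ≤ x → ρ x ^ p = L (evalRpow 𝕜 hp0.le x) := fun x hx => by
    rw [hρ, modulus_of_nonneg hx, hinv' (hnn x)]
  refine ⟨ρ, (C ^ (1 / p)) ^ m, by positivity, fun z => ?_, fun a z ha haz => ?_,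
    fun n x hx => ?_, fun x hx => ?_⟩
  · rw [hρ]
    have h1 : L (evalRpow 𝕜 hp0.le (modulus 𝕜 z)) ≤ ‖z‖ ^ p := by
      rw [← mul_one (‖z‖ ^ p), ← hL1, ← smul_eq_mul, ← map_smul]
      refine hmono _ _ fun φ => ?_
      rw [BoundedContinuousFunction.coe_smul, evalRpow_apply, ← norm_modulus (𝕜 := 𝕜) z]
      simpa using Real.rpow_le_rpow (norm_nonneg _) (norm_apply_le_of_mem φ (modulus 𝕜 z)) hp0.le
    exact (Real.rpow_le_rpow (hnn _) h1 (by positivity)).trans_eq (hinv (norm_nonneg _))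
  · rw [hρ, hρ, modulus_of_nonneg ha]
    exact Real.rpow_le_rpow (hnn _) (hmono _ _ fun φ =>
      Real.rpow_le_rpow (norm_nonneg _) (norm_apply_mono φ ha haz) hp0.le) (by positivity)
  · have h1 : ∑ i, ρ (x i) ^ p = L (∑ i, evalRpow 𝕜 hp0.le (x i)) := by
      rw [map_sum]
      exact Finset.sum_congr rfl fun i _ => hρ' _ (hx i)
    rw [h1, ← mul_one (positiveWeakSup 𝕜 p x), ← hL1, ← smul_eq_mul, ← map_smul]
    refine hmono _ _ fun φ => ?_
    simpa [evalRpow_apply] using le_positiveWeakSup hp0.le x φ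
  · have h1 := hLP x hx
    rw [← hρ' x hx] at h1
    have h2 := Real.rpow_le_rpow (Real.rpow_nonneg (norm_nonneg _) _) h1
      (z := m / p) (by positivity)
    have h3 : p / m * (m / p) = 1 := by field_simp
    have h4 : ∀ {r : ℝ}, 0 ≤ r → r ^ ((m : ℝ) / p) = (r ^ (1 / p)) ^ m := fun {r} hr => by
      rw [← Real.rpow_natCast, ← Real.rpow_mul hr]
      congr 1
      ring
    rwa [← Real.rpow_mul (norm_nonneg _), h3, Real.rpow_one,
      Real.mul_rpow hC.le (Real.rpow_nonneg (apply_nonneg ρ x) _), h4 hC.le,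
      h4 (Real.rpow_nonneg (apply_nonneg ρ x) _), hinv (apply_nonneg ρ x)] at h2

/-- A symmetric multilinear map whose diagonal is bounded by a monotone seminorm on the positive
cone is bounded by that seminorm. -/
theorem exists_multilinear_bound {Y : Type u} [NormedAddCommGroup Y] [NormedSpace 𝕜 Y]
    {m : ℕ} (A : MultilinearMap 𝕜 (fun _ : Fin m => E) Y)
    (hA : ∀ (σ : Equiv.Perm (Fin m)) (x : Fin m → E), A (fun i => x (σ i)) = A x)
    (ρ : Seminorm 𝕜 E) (hρ : ∀ a z, 0 ≤ a → a ≤ modulus 𝕜 z → ρ a ≤ ρ z)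
    {C : ℝ} (hC : 0 ≤ C) (hAC : ∀ x, 0 ≤ x → ‖A fun _ => x‖ ≤ C * ρ x ^ m) :
    ∃ D : ℝ, 0 ≤ D ∧ ∀ z, ‖A z‖ ≤ D * ∏ i, ρ (z i) := by
  have := BanachLattice.isOrderedAddMonoid 𝕜 E
  -- Since `ρ (a i)` may vanish, normalization uses positive upper bounds `r i`. A sum of at most
  -- `m` normalized vectors has `ρ ≤ m`, which produces `m ^ m`.
  have hpos : ∀ (a : Fin m → E) (r : Fin m → ℝ), (∀ i, 0 ≤ a i) → (∀ i, 0 < r i) →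
      (∀ i, ρ (a i) ≤ r i) → ‖A a‖ ≤ 2 ^ m * (C * m ^ m) * ∏ i, r i := fun a r ha hr har => by
    let y : Fin m → E := fun i => (((r i)⁻¹ : ℝ) : 𝕜) • a i
    have hy : ∀ i, 0 ≤ y i := fun i =>
      BanachLattice.smul_nonneg _ _ (inv_pos.2 (hr i)).le (ha i)
    have hρy : ∀ i, ρ (y i) ≤ 1 := fun i => by
      rw [map_smul_eq_mul, RCLike.norm_ofReal, abs_of_pos (inv_pos.2 (hr i)),
        inv_mul_le_one₀ (hr i)]
      exact har i
    have h1 : ‖A y‖ ≤ 2 ^ m * (C * m ^ m) := norm_le_of_norm_diagonal_le A hA y fun S => by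
      refine (hAC _ (Finset.sum_nonneg fun i _ => hy i)).trans ?_
      gcongr
      calc ρ (∑ i ∈ S, y i) ≤ ∑ i ∈ S, ρ (y i) :=
            Finset.le_sum_of_subadditive ρ (map_zero ρ).le (map_add_le_add ρ) S y
        _ ≤ ∑ _i ∈ S, (1 : ℝ) := Finset.sum_le_sum fun i _ => hρy i
        _ ≤ m := by
          simpa using (Finset.card_le_univ S)
    have h2 : a = fun i => ((r i : ℝ) : 𝕜) • y i := funext fun i => by
      rw [smul_smul, ← RCLike.ofReal_mul, mul_inv_cancel₀ (hr i).ne', RCLike.ofReal_one, one_smul]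
    rw [h2, A.map_smul_univ, norm_smul, norm_prod, mul_comm]
    simp only [RCLike.norm_ofReal, abs_of_pos (hr _)]
    have h3 : 0 ≤ ∏ i, r i := Finset.prod_nonneg fun i _ => (hr i).le
    gcongr
  choose c a hc ha hz using exists_eq_sum_nonneg 𝕜 (E := E)
  have hgen : ∀ (z : Fin m → E) (r : Fin m → ℝ), (∀ i, 0 < r i) → (∀ i, ρ (z i) ≤ r i) →
      ‖A z‖ ≤ 4 ^ m * (2 ^ m * (C * m ^ m)) * ∏ i, r i := fun z r hr hzr => by
    have h1 : A z = ∑ s : Fin m → Fin 4, A fun i => c (z i) (s i) • a (z i) (s i) := by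
      rw [← A.map_sum fun i j => c (z i) j • a (z i) j]
      exact congrArg A (funext fun i => hz (z i))
    rw [h1]
    refine (norm_sum_le_of_le (n := fun _ => 2 ^ m * (C * m ^ m) * ∏ i, r i) _
      fun s _ => ?_).trans_eq ?_
    · rw [A.map_smul_univ, norm_smul, norm_prod]
      have h2 : ∏ i, ‖c (z i) (s i)‖ ≤ 1 :=
        Finset.prod_le_one (fun _ _ => norm_nonneg _) fun i _ => hc _ _
      have h3 := hpos (fun i => a (z i) (s i)) r (fun i => (ha _ _).1) hr
        fun i => (hρ _ _ (ha _ _).1 (ha _ _).2).trans (hzr i)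
      calc _ ≤ 1 * ‖A fun i => a (z i) (s i)‖ := by gcongr
        _ ≤ _ := by rwa [one_mul]
    · simp [mul_assoc]
  refine ⟨4 ^ m * (2 ^ m * (C * m ^ m)), by positivity, fun z => ?_⟩
  -- Take `r i = ρ (z i) + ε` and let `ε` decrease to `0`.
  have hcont : Continuous fun ε : ℝ => 4 ^ m * (2 ^ m * (C * m ^ m)) * ∏ i, (ρ (z i) + ε) := by
    fun_prop
  have hlim := (hcont.tendsto 0).mono_left (nhdsWithin_le_nhds (s := Set.Ioi 0))
  simp only [add_zero] at hlim
  refine ge_of_tendsto hlim ?_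
  filter_upwards [self_mem_nhdsWithin] with ε hε
  exact hgen z _ (fun i => add_pos_of_nonneg_of_pos (apply_nonneg ρ _) hε)
    fun i => le_add_of_nonneg_right (le_of_lt hε)

theorem exists_factorization_of_dominated {Y : Type u} [NormedAddCommGroup Y] [NormedSpace 𝕜 Y]
    [CompleteSpace Y] {m : ℕ} (hm : 0 < (m : ℝ)) {p : ℝ} (hp : 1 ≤ p) {P : E → Y}
    (hP : P ∈ PositiveDominated 𝕜 m p E Y) :
    P ∈ Factorization m (PositiveSumming.{u, w} 𝕜 p) E Y := by
  have hp0 : 0 < p := by linarith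
  obtain ⟨hPc, hPd⟩ := (mem_positiveDominated_iff hp0 hm).1 hP
  obtain ⟨ρ, C, hC, hρn, hρm, hρs, hρP⟩ := exists_seminorm_of_dominated hm hp hPc hPd
  obtain ⟨A, hAs, hA⟩ := hPc
  obtain ⟨D, hD, hAD⟩ := exists_multilinear_bound A.toMultilinearMap hAs ρ hρm hC
    fun x hx => (congrArg norm (hA x)).symm.trans_le (hρP x hx)
  obtain ⟨X, _, _, _, e, he, hen⟩ := exists_completion_of_seminorm ρ
  obtain ⟨B, hB⟩ := exists_continuousMultilinearMap_extension e he A.toMultilinearMap D hD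
    fun x => by simpa only [hen] using hAD x
  refine ⟨X, inferInstance, inferInstance, inferInstance,
    e.mkContinuous 1 fun x => by rw [hen, one_mul]; exact hρn x, fun x => B fun _ => x, ?_,
    diagonal_mem_contPoly B, ?_⟩
  · rw [mem_positiveSumming_iff hp0]
    refine ⟨1, one_pos, fun n x hx => ?_⟩
    simpa only [LinearMap.mkContinuous_apply, hen, one_mul] using hρs n x hx
  · exact funext fun x => (hA x).trans (hB fun _ => x).symm

theorem positiveDominated_eq_factorization {Y : Type u} [NormedAddCommGroup Y] [NormedSpace 𝕜 Y]
    [CompleteSpace Y] {m : ℕ} (hm : 0 < (m : ℝ)) {p : ℝ} (hp : 1 ≤ p) :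
    PositiveDominated 𝕜 m p E Y = Factorization m (PositiveSumming.{u, w} 𝕜 p) E Y := by
  have hp0 : 0 < p := by linarith
  refine Set.Subset.antisymm (fun P => exists_factorization_of_dominated hm hp) ?_
  rintro P ⟨X, _, _, _, T, Q, hT, hQ, rfl⟩
  refine (mem_positiveDominated_iff hp0 hm).2
    ⟨contPoly_comp hQ T (ContinuousLinearMap.id 𝕜 Y), ?_⟩
  obtain ⟨C, hC, hQC⟩ := exists_norm_le_of_mem_contPoly hQ
  refine mem_dominatedSubmodule_of_le (f := T) (q := p) (D := C ^ (p / m)) _ (by positivity)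
    ((mem_positiveSumming_iff hp0).1 hT) fun x _ => ?_
  rw [← rpow_div_natCast_pow (norm_nonneg (T x)) hm, ← Real.mul_rpow hC (by positivity)]
  exact Real.rpow_le_rpow (norm_nonneg _) (hQC _) (by positivity)

end Pietsch

/-! ### Ideal properties -/

section Ideals

variable {𝕜 : Type w} [RCLike 𝕜]

theorem isPositiveRightOperatorIdeal_positiveSumming {p : ℝ} (hp : 0 < p) :
    IsPositiveRightOperatorIdeal (PositiveSumming.{u, w} 𝕜 p) where
  isSubspace E _ _ _ _ X _ _ _ := by
    let c : (E →L[𝕜] X) →ₗ[𝕜] (E → X) :=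
      { toFun := fun T => T, map_add' := fun _ _ => rfl, map_smul' := fun _ _ => rfl }
    exact ⟨(dominatedSubmodule 𝕜 E X p hp).comap c,
      Set.ext fun T => (mem_positiveSumming_iff hp).symm⟩
  finiteRank E _ _ _ _ X _ _ _ T hT := by
    rw [mem_positiveSumming_iff hp]
    let b := Module.finBasis 𝕜 (LinearMap.range (T : E →ₗ[𝕜] X))
    let φ := fun j => (LinearMap.toContinuousLinearMap (b.coord j)).comp
      (T.codRestrict (LinearMap.range (T : E →ₗ[𝕜] X)) fun x => ⟨x, rfl⟩)
    -- Coordinates in a basis of the range split `T` into rank-one terms, each controlled by a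
    -- single functional.
    have h1 : (T : E → X) = ∑ j, fun x => φ j x • (b j : X) := funext fun x => by
      have h2 := congrArg Subtype.val (b.sum_repr ⟨T x, x, rfl⟩)
      rw [Finset.sum_apply, ← show _ = T x from h2, Submodule.coe_sum]
      rfl
    rw [h1]
    refine Submodule.sum_mem _ fun j _ => ?_
    refine mem_dominatedSubmodule_of_le (f := φ j) (q := p) (D := ‖(b j : X)‖ ^ p) _
      (by positivity) (exists_sum_norm_functional_le hp.le (φ j)) fun x _ => ?_
    rw [norm_smul, Real.mul_rpow (norm_nonneg _) (norm_nonneg _), mul_comm]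
  comp E _ _ _ _ G _ _ _ _ X _ _ _ Z _ _ _ T u v hT hu := by
    rw [mem_positiveSumming_iff hp] at hT ⊢
    refine mem_dominatedSubmodule_of_le (f := fun x => T (u x)) (q := p) (D := ‖v‖ ^ p) _
      (by positivity) (mem_dominatedSubmodule_comp hp.le hp hT hu) fun x _ => ?_
    rw [← Real.mul_rpow (norm_nonneg _) (norm_nonneg _)]
    exact Real.rpow_le_rpow (norm_nonneg _) (v.le_opNorm _) hp.le

theorem isPositiveRightPolynomialIdeal_positiveDominated {m : ℕ} (hm : 0 < (m : ℝ)) {p : ℝ}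
    (hp : 1 ≤ p) :
    IsPositiveRightPolynomialIdeal m (PositiveDominated.{u, w} 𝕜 m p) where
  isSubspace E _ _ _ _ Y _ _ _ := by
    have hp0 : 0 < p := by linarith
    exact ⟨fun P hP => hP.1,
      contPolySubmodule 𝕜 m E Y ⊓ dominatedSubmodule 𝕜 E Y p (div_pos hp0 hm),
      Set.ext fun P => (mem_positiveDominated_iff hp0 hm).symm⟩
  finiteType E _ _ _ _ Y _ _ _ := by
    have hp0 : 0 < p := by linarith
    rintro P ⟨k, φ, y, hP⟩
    have h1 : P = ∑ j, fun x => φ j x ^ m • y j := funext fun x => by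
      rw [hP, Finset.sum_apply]
    rw [mem_positiveDominated_iff hp0 hm, h1]
    refine ⟨Submodule.sum_mem (contPolySubmodule 𝕜 m E Y) fun j _ =>
      pow_smul_mem_contPoly 𝕜 m (φ j) (y j), Submodule.sum_mem _ fun j _ => ?_⟩
    refine mem_dominatedSubmodule_of_le (f := φ j) (q := p) (D := ‖y j‖ ^ (p / m)) _
      (by positivity) (exists_sum_norm_functional_le hp0.le (φ j)) fun x _ => ?_
    rw [norm_smul, norm_pow, Real.mul_rpow (by positivity) (norm_nonneg _), mul_comm,
      rpow_div_natCast_pow (norm_nonneg _) hm]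
  comp E _ _ _ _ G _ _ _ _ Y _ _ _ Z _ _ _ P u v hP hu := by
    have hp0 : 0 < p := by linarith
    -- In factored form, `u` is absorbed by the operator ideal and `v` by the polynomial on `X`.
    rw [positiveDominated_eq_factorization hm hp] at hP ⊢
    obtain ⟨X, _, _, _, T, Q, hT, hQ, rfl⟩ := hP
    exact ⟨X, inferInstance, inferInstance, inferInstance, T.comp u, fun x => v (Q x),
      (isPositiveRightOperatorIdeal_positiveSumming hp0).comp E G X X T u
        (ContinuousLinearMap.id 𝕜 X) hT hu,
      contPoly_comp hQ (ContinuousLinearMap.id 𝕜 X) v, rfl⟩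

end Ideals
end PositiveIdeals

theorem mainTheorem4 {𝕜 : Type w} [RCLike 𝕜] (m : ℕ) (hm : 1 ≤ m) (p : ℝ) (hp : 1 ≤ p) :
    PositiveIdeals.IsPositiveRightOperatorIdeal (PositiveIdeals.PositiveSumming.{u, w} 𝕜 p) ∧
    PositiveIdeals.IsPositiveRightPolynomialIdeal m
      (PositiveIdeals.PositiveDominated.{u, w} 𝕜 m p) ∧
    ∀ (E : Type u) [NormedAddCommGroup E] [NormedSpace 𝕜 E] [PartialOrder E]
      [PositiveIdeals.BanachLattice 𝕜 E]
      (Y : Type u) [NormedAddCommGroup Y] [NormedSpace 𝕜 Y] [CompleteSpace Y],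
      PositiveIdeals.PositiveDominated.{u, w} 𝕜 m p E Y =
        PositiveIdeals.Factorization m (PositiveIdeals.PositiveSumming.{u, w} 𝕜 p) E Y := by
  have hp0 : 0 < p := by linarith
  have hm0 : 0 < (m : ℝ) := by exact_mod_cast hm
  exact ⟨PositiveIdeals.isPositiveRightOperatorIdeal_positiveSumming hp0,
    PositiveIdeals.isPositiveRightPolynomialIdeal_positiveDominated hm0 hp,
    fun E _ _ _ _ Y _ _ _ => PositiveIdeals.positiveDominated_eq_factorization hm0 hp⟩
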